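/- Let $r\ge 2$ be an integer. A channel $P$ from $\{+,-\}$ to a measurable space $\mathcal Y$ is called BMS (binary memoryless symmetric) if there is a measurable involution $\sigma$ of $\mathcal Y$ with $P(E\mid +)=P(\sigma(E)\mid -)$ for all measurable $E\subseteq\mathcal Y$. For a channel $P$ with input alphabet $\{+,-\}$, let $C_{\chi^2}(P)=I_{\chi^2}(X;Y)$, where $X$ is uniform on $\{+,-\}$, $Y$ is the output of $P$ on input $X$, and $I_{\chi^2}(X;Y)$ is the $\chi^2$-divergence of the joint law of $(X,Y)$ from the product of its marginals. Let $P^{\times n}$ denote the $n$-fold tensor power of $P$ (independent use of $P$ on $n$ inputs), and let $\mathrm{BEC}_\delta$ denote the binary erasure channel with erasure probability $\delta$. For a channel $B:\{+,-\}\to\{+,-\}^{r-1}$ define $$\eta^{(m,s)}_{\chi^2}(B)=\sup_P\frac{C_{\chi^2}(P^{\times(r-1)}\circ B)}{(r-1)\,C_{\chi^2}(P)},$$ where $P$ ranges over all BMS channels with $0<C_{\chi^2}(P)<\infty$, and for $0<\epsilon\le 1$ define $$f_B(\epsilon)=\frac{1}{(r-1)\epsilon}\,C_{\chi^2}\bigl(\mathrm{BEC}_{1-\epsilon}^{\times(r-1)}\circ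 B\bigr).$$ (a) Suppose that $B:\{+,-\}\to\{+,-\}^{r-1}$ is BMS with the coordinatewise sign flip as its involution. Then $f_B$ and $\eta^{(m,s)}_{\chi^2}(B)$ are finite, $$\eta^{(m,s)}_{\chi^2}(B)=\sup_{0<\epsilon\le 1}f_B(\epsilon),$$ and on $(0,1]$ the function $f_B$ agrees with a polynomial of degree at most $r-2$. (b) For $\lambda\in[0,1]$ let $B_{r,\lambda}:\{+,-\}\to\{+,-\}^{r-1}$ be given by $$B_{r,\lambda}(x_1,\dots,x_{r-1}\mid y)=\begin{cases}\lambda+\frac{1}{2^{r-1}}(1-\lambda), & x_i=y \text{ for all } i,\\ \frac{1}{2^{r-1}}(1-\lambda), & \text{otherwise.}\end{cases}$$ Then $B_{r,\lambda}$ satisfies the hypothesis of (a), and for $0<\epsilon\le 1$ $$f_{B_{r,\lambda}}(\epsilon)=f_{r,\lambda}(\epsilon):=\frac{1}{r-1}\sum_{i=1}^{r-1}\binom{r-1}{i}(1-\epsilon)^{r-1-i}\epsilon^{i-1}\,\frac{\lambda^2}{\lambda+(1-\lambda)2^{1-i}},$$ so that $\eta^{(m,s)}_{\chi^2}(B_{r,\lambda})=\sup_{0<\epsilon\le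 1}f_{r,\lambda}(\epsilon)$. -/

import Mathlib

open MeasureTheory ProbabilityTheory
open scoped ENNReal

universe u

namespace MultiSDPI

/-! The binary alphabet `{+, -}` is `Bool`, with `true` for `+` and `false` for `-`. A channel is a
Markov kernel. -/

section Channels

variable {Y : Type*} [MeasurableSpace Y]

/-- `P` is a binary memoryless symmetric channel, the symmetry being witnessed by the measurable
involution `σ` of the output alphabet. -/
structure IsBMSWith (P : Kernel Bool Y) (σ : Y → Y) : Prop where
  markov : IsMarkovKernel P
  measurable : Measurable σ
  involutive : Function.Involutive σ
  symm : ∀ E : Set Y, MeasurableSet E → P true E = P false (σ '' E)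

/-- `P` is a binary memoryless symmetric (BMS) channel. -/
def IsBMS (P : Kernel Bool Y) : Prop :=
  ∃ σ : Y → Y, IsBMSWith P σ

/-- The `n`-th tensor power of a binary-input channel: `n` inputs pass independently through
`P`. -/
noncomputable def tensorPow (P : Kernel Bool Y) (n : ℕ) :
    Kernel (Fin n → Bool) (Fin n → Y) :=
  Kernel.ofFunOfCountable fun x => Measure.pi fun i => P (x i)

open Classical in
/-- The `χ²`-divergence, that is the `f`-divergence for `f x = (x - 1) ^ 2`. It is infinite if `μ`
is not absolutely continuous with respect to `ν`. -/
noncomputable def chiSqDiv (μ ν : Measure Y) : ℝ≥0∞ :=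
  if μ ≪ ν then ∫⁻ y, ENNReal.ofReal (((μ.rnDeriv ν y).toReal - 1) ^ 2) ∂ν else ⊤

/-- The `χ²`-information `I(π, P)`: the `χ²`-divergence of the joint law of input and output from
the product of their laws, for an input of law `π` and the channel `P`. -/
noncomputable def chiSqInfo {X : Type*} [MeasurableSpace X] (π : Measure X) (P : Kernel X Y) :
    ℝ≥0∞ :=
  chiSqDiv (π ⊗ₘ P) (π.prod (P ∘ₘ π))

/-- The uniform distribution on `{+, -}`. -/
noncomputable def unifSign : Measure Bool :=
  (2 : ℝ≥0∞)⁻¹ • (Measure.dirac true + Measure.dirac false)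

/-- The `χ²`-capacity: the `χ²`-information under a uniform input. -/
noncomputable def chiSqCapacity (P : Kernel Bool Y) : ℝ≥0∞ :=
  chiSqInfo unifSign P

end Channels

/-- The coordinatewise sign flip on `{+, -}ⁿ`. -/
def signFlip (n : ℕ) (x : Fin n → Bool) : Fin n → Bool :=
  fun i => !(x i)

/-- The `χ²` multi-terminal contraction coefficient of a broadcast channel
`B : {+, -} → {+, -}^(r-1)` over BMS channels: the supremum of
`C(P^{×(r-1)} ∘ B) / ((r-1) C(P))` over the BMS channels `P` with `0 < C(P) < ∞`. -/
noncomputable def multiCoeff (r : ℕ) (B : Kernel Bool (Fin (r - 1) → Bool)) : ℝ≥0∞ :=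
  ⨆ (Y : Type u) (_ : MeasurableSpace Y) (P : Kernel Bool Y) (_ : IsBMS P)
    (_ : 0 < chiSqCapacity P) (_ : chiSqCapacity P < ⊤),
    chiSqCapacity (tensorPow P (r - 1) ∘ₖ B) / (((r - 1 : ℕ) : ℝ≥0∞) * chiSqCapacity P)

/-- The output alphabet of an erasure channel. -/
inductive ErasureOutput : Type
  | sign (x : Bool)
  | erased

instance : MeasurableSpace ErasureOutput := ⊤

/-- The binary erasure channel with erasure probability `δ`, for `0 ≤ δ ≤ 1`. -/
noncomputable def bec (δ : ℝ) : Kernel Bool ErasureOutput :=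
  Kernel.ofFunOfCountable fun x =>
    ENNReal.ofReal (1 - δ) • Measure.dirac (ErasureOutput.sign x) +
      ENNReal.ofReal δ • Measure.dirac ErasureOutput.erased

/-- The channel `BEC_{1-ε}^{×(r-1)} ∘ B`. -/
noncomputable def erasedBroadcast (r : ℕ) (B : Kernel Bool (Fin (r - 1) → Bool)) (ε : ℝ) :
    Kernel Bool (Fin (r - 1) → ErasureOutput) :=
  tensorPow (bec (1 - ε)) (r - 1) ∘ₖ B

/-- `f_B(ε) = C(BEC_{1-ε}^{×(r-1)} ∘ B) / ((r-1) ε)`. -/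
noncomputable def fBroadcast (r : ℕ) (B : Kernel Bool (Fin (r - 1) → Bool)) (ε : ℝ) : ℝ :=
  (chiSqCapacity (erasedBroadcast r B ε)).toReal / (((r : ℝ) - 1) * ε)

/-- The channel `B_{r,lam}`, for `0 ≤ lam ≤ 1`: given `y`, the output `x` has probability
`lam + (1 - lam) / 2^(r-1)` if all its coordinates equal `y`, and `(1 - lam) / 2^(r-1)` otherwise. -/
noncomputable def specialBroadcast (r : ℕ) (lam : ℝ) : Kernel Bool (Fin (r - 1) → Bool) :=
  Kernel.ofFunOfCountable fun y =>
    ∑ x : Fin (r - 1) → Bool,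
      ENNReal.ofReal
          (if ∀ i, x i = y then lam + 1 / 2 ^ (r - 1) * (1 - lam) else 1 / 2 ^ (r - 1) * (1 - lam)) •
        Measure.dirac x

/-- The explicit function `f_{r,lam}`. -/
noncomputable def fSpecial (r : ℕ) (lam ε : ℝ) : ℝ :=
  1 / ((r : ℝ) - 1) *
    ∑ i ∈ Finset.Icc 1 (r - 1),
      ((r - 1).choose i : ℝ) * (1 - ε) ^ (r - 1 - i) * ε ^ (i - 1) *
        (lam ^ 2 / (lam + (1 - lam) * (2 : ℝ) ^ (1 - (i : ℤ))))

end MultiSDPI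

namespace MultiSDPI

/-! Write `Q` for the output law of a BMS channel `P` under uniform input. Its two conditional laws
have densities `1 ± h` with respect to `Q`, where `|h| ≤ 1` and `h ∘ σ = -h`, and `C(P) = ∫ h² dQ`
(`IsBMSWith.exists_hasCorrelation`, `HasCorrelation.chiSqCapacity_eq`). With `n = r - 1`, the
capacity of `P^{×n} ∘ B` is the integral of `G(h(z₁), …, h(zₙ))` against `Qⁿ`, where `G =
chiSqIntegrand` is the squared half-difference of two multi-affine likelihoods divided by their
half-sum. Since `σ` preserves `Q` and negates `h`, `G` may be averaged over independent signs
`±h(zᵢ)`. In one coordinate, `sq_div_affine_le` shows that this average does not decrease when `±u`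
is replaced by the law on `{0, 1, -1}` with weights `1 - u², u²/2, u²/2`; `symmetrized_le_erased`
does this in every coordinate. These weights are affine in `u²`, so integrating them leaves a
quantity depending on `P` only through `C(P)`: `erasedMean` at `C(P)`. For an erasure channel `h`
takes only the values `0, ±1` and equality holds. Hence the ratio for `P` is at most `f_B(C(P))`, it
is attained by an erasure channel, and `C(P)` lies in `(0, 1]`. `erasedMean` is a finite sum of
terms `(u/2)^k (1-u)^(n-k) G(w)`, where `k` counts the unerased signs of `w`. The term `k = 0`
vanishes, so dividing by `u` leaves degree at most `n - 1 = r - 2`. For `B_{r,λ}`, `G(w)` vanishes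
unless the unerased signs of `w` all agree; then it depends only on `k`, and counting the patterns
`w` gives `fSpecial`. -/

/-! ### The `χ²`-capacity through densities -/

theorem lintegral_unifSign (f : Bool → ℝ≥0∞) :
    ∫⁻ x, f x ∂unifSign = 2⁻¹ * (f true + f false) := by
  simp [unifSign, lintegral_smul_measure, lintegral_add_measure, mul_add]

instance : IsProbabilityMeasure unifSign := by
  constructor
  simp only [unifSign, Measure.smul_apply, Measure.add_apply, measure_univ, smul_eq_mul]
  rw [one_add_one_eq_two]
  exact ENNReal.inv_mul_cancel (by simp) (by simp)

theorem inv_two_mul_ofReal_add {a b : ℝ} (ha : 0 ≤ a) (hb : 0 ≤ b) :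
    (2 : ℝ≥0∞)⁻¹ * (ENNReal.ofReal a + ENNReal.ofReal b) = ENNReal.ofReal ((a + b) / 2) := by
  rw [← ENNReal.ofReal_add ha hb, div_eq_inv_mul, ENNReal.ofReal_mul (by norm_num),
    ENNReal.ofReal_inv_of_pos (by norm_num)]
  simp

/-- The output law under a uniform input has the averaged density. -/
theorem comp_unifSign_eq_withDensity {Y : Type*} [MeasurableSpace Y] (K : Kernel Bool Y)
    (Q : Measure Y) (p : Bool → Y → ℝ) (hp : ∀ x, Measurable (p x)) (h0 : ∀ x y, 0 ≤ p x y)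
    (hK : ∀ x, K x = Q.withDensity fun y => ENNReal.ofReal (p x y)) :
    K ∘ₘ unifSign = Q.withDensity fun y => ENNReal.ofReal ((p true y + p false y) / 2) := by
  have := hp true
  have := hp false
  ext s hs
  rw [Measure.bind_apply hs K.measurable.aemeasurable, lintegral_unifSign, hK, hK,
    withDensity_apply _ hs, withDensity_apply _ hs, withDensity_apply _ hs,
    ← lintegral_add_left (by fun_prop), ← lintegral_const_mul _ (by fun_prop)]
  exact lintegral_congr fun y => inv_two_mul_ofReal_add (h0 _ _) (h0 _ _)

/-- The `χ²`-capacity in terms of densities with respect to a common reference measure. -/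
theorem chiSqCapacity_eq_lintegral {Y : Type*} [MeasurableSpace Y] (K : Kernel Bool Y)
    [IsMarkovKernel K] (Q : Measure Y) [SFinite Q] (p : Bool → Y → ℝ)
    (hp : ∀ x, Measurable (p x)) (h0 : ∀ x y, 0 ≤ p x y)
    (hK : ∀ x, K x = Q.withDensity fun y => ENNReal.ofReal (p x y)) :
    chiSqCapacity K = ∫⁻ y, ENNReal.ofReal
      (((p true y - p false y) / 2) ^ 2 / ((p true y + p false y) / 2)) ∂Q := by
  have hout := comp_unifSign_eq_withDensity K Q p hp h0 hK
  have hpt := hp true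
  have hpf := hp false
  have hpu : Measurable fun z : Bool × Y => p z.1 z.2 := measurable_from_prod_countable_right hp
  set q : Y → ℝ := fun y => (p true y + p false y) / 2 with hq
  have hqm : Measurable q := by fun_prop
  have hp0 : ∀ x y, q y = 0 → p x y = 0 := by
    intro x y h
    have := h0 true y
    have := h0 false y
    simp only [hq] at h
    cases x <;> linarith
  have hq0 : ∀ y, 0 ≤ q y := fun y => by
    have := h0 true y
    have := h0 false y
    simp only [hq]; linarith
  have hprob : IsProbabilityMeasure (Q.withDensity fun y => ENNReal.ofReal (q y)) := by
    rw [← hout]; infer_instance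
  have hfubini : ∀ f : Bool × Y → ℝ≥0∞, Measurable f →
      ∫⁻ z, f z ∂(unifSign.prod (K ∘ₘ unifSign)) =
        2⁻¹ * ((∫⁻ y, ENNReal.ofReal (q y) * f (true, y) ∂Q) +
          ∫⁻ y, ENNReal.ofReal (q y) * f (false, y) ∂Q) := by
    intro f hf
    rw [lintegral_prod _ hf.aemeasurable, lintegral_unifSign, hout,
      lintegral_withDensity_eq_lintegral_mul _ (by fun_prop) (by fun_prop),
      lintegral_withDensity_eq_lintegral_mul _ (by fun_prop) (by fun_prop)]
    rfl
  have hjoint : unifSign ⊗ₘ K = (unifSign.prod (K ∘ₘ unifSign)).withDensity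
      (fun z => ENNReal.ofReal (p z.1 z.2 / q z.2)) := by
    ext s hs
    have hsx : ∀ x : Bool, MeasurableSet (Prod.mk x ⁻¹' s) := fun x => measurable_prodMk_left hs
    rw [Measure.compProd_apply hs, lintegral_unifSign, withDensity_apply _ hs,
      ← lintegral_indicator hs, hfubini _ (Measurable.indicator (by fun_prop) hs), hK, hK,
      withDensity_apply _ (hsx _), withDensity_apply _ (hsx _), ← lintegral_indicator (hsx _),
      ← lintegral_indicator (hsx _)]
    have key : ∀ x y, (Prod.mk x ⁻¹' s).indicator (fun y => ENNReal.ofReal (p x y)) y =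
        ENNReal.ofReal (q y) *
          s.indicator (fun z : Bool × Y => ENNReal.ofReal (p z.1 z.2 / q z.2)) (x, y) := by
      intro x y
      by_cases h : (x, y) ∈ s
      · rw [Set.indicator_of_mem h, Set.indicator_of_mem (by exact h),
          ← ENNReal.ofReal_mul (hq0 y)]
        congr 1
        -- Where the averaged density vanishes, so do both densities, and `0 / 0 = 0` does no harm.
        by_cases hz : q y = 0
        · rw [hp0 x y hz]; simp
        · field_simp
      · rw [Set.indicator_of_notMem h, Set.indicator_of_notMem (by exact h), mul_zero]
    simp_rw [key]
  have hac : unifSign ⊗ₘ K ≪ unifSign.prod (K ∘ₘ unifSign) := by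
    rw [hjoint]; exact withDensity_absolutelyContinuous _ _
  have hrn : (unifSign ⊗ₘ K).rnDeriv (unifSign.prod (K ∘ₘ unifSign))
      =ᵐ[unifSign.prod (K ∘ₘ unifSign)] fun z => ENNReal.ofReal (p z.1 z.2 / q z.2) := by
    conv_lhs => rw [hjoint]
    exact Measure.rnDeriv_withDensity _ (by fun_prop)
  rw [chiSqCapacity, chiSqInfo, chiSqDiv, if_pos hac]
  have : ∫⁻ z, ENNReal.ofReal
      ((((unifSign ⊗ₘ K).rnDeriv (unifSign.prod (K ∘ₘ unifSign)) z).toReal - 1) ^ 2)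
        ∂(unifSign.prod (K ∘ₘ unifSign)) =
      ∫⁻ z, ENNReal.ofReal ((p z.1 z.2 / q z.2 - 1) ^ 2) ∂(unifSign.prod (K ∘ₘ unifSign)) := by
    refine lintegral_congr_ae ?_
    filter_upwards [hrn] with z hz
    rw [hz, ENNReal.toReal_ofReal (div_nonneg (h0 _ _) (hq0 _))]
  rw [this, hfubini _ (by fun_prop), ← lintegral_add_left (by fun_prop),
    ← lintegral_const_mul _ (by fun_prop)]
  refine lintegral_congr fun y => ?_
  rw [← ENNReal.ofReal_mul (hq0 y), ← ENNReal.ofReal_mul (hq0 y),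
    inv_two_mul_ofReal_add (mul_nonneg (hq0 y) (sq_nonneg _)) (mul_nonneg (hq0 y) (sq_nonneg _))]
  congr 1
  change _ = ((p true y - p false y) / 2) ^ 2 / q y
  by_cases hz : q y = 0
  · rw [hz]; simp
  -- The deviations `p x y / q y - 1` for the two inputs are opposite, so their squares coincide.
  · have hd : p false y = 2 * q y - p true y := by simp only [hq]; ring
    rw [hd]
    field_simp
    ring

/-! ### Likelihoods of noisy signs -/

/-- The real value of a sign. -/
def sgn (x : Bool) : ℝ := if x then 1 else -1

/-- The real value of an erased sign. -/
def erasedVal : Option Bool → ℝ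
  | none => 0
  | some x => sgn x

/-- The law of an erased sign with second moment `u`. -/
noncomputable def erasedWeight (u : ℝ) : Option Bool → ℝ
  | none => 1 - u
  | some _ => u / 2

theorem erasedWeight_nonneg {u : ℝ} (h0 : 0 ≤ u) (h1 : u ≤ 1) (a : Option Bool) :
    0 ≤ erasedWeight u a := by
  cases a <;> simp only [erasedWeight] <;> linarith

/-- The likelihood of an observation of signs with correlations `t`, for a prior `b`. -/
noncomputable def likelihood {n : ℕ} (b : (Fin n → Bool) → ℝ) (t : Fin n → ℝ) : ℝ :=
  ∑ x, b x * ∏ i, (1 + sgn (x i) * t i)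

/-- The `χ²` integrand for the two priors `b true` and `b false`. -/
noncomputable def chiSqIntegrand {n : ℕ} (b : Bool → (Fin n → Bool) → ℝ) (t : Fin n → ℝ) : ℝ :=
  ((likelihood (b true) t - likelihood (b false) t) / 2) ^ 2 /
    ((likelihood (b true) t + likelihood (b false) t) / 2)

theorem sum_fin_succ_cons {α : Type*} [Fintype α] {n : ℕ} (F : (Fin (n + 1) → α) → ℝ) :
    ∑ x, F x = ∑ a, ∑ x : Fin n → α, F (Fin.cons a x) := by
  rw [← Fintype.sum_prod_type']
  exact (Fintype.sum_equiv (Fin.consEquiv fun _ => α) _ _ fun _ => rfl).symm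

theorem one_add_sgn_mul_nonneg {u : ℝ} (hu : |u| ≤ 1) (x : Bool) : 0 ≤ 1 + sgn x * u := by
  rw [abs_le] at hu
  cases x <;> simp [sgn] <;> linarith

theorem abs_sgn_mul (x : Bool) (u : ℝ) : |sgn x * u| = |u| := by
  cases x <;> simp [sgn]

theorem likelihood_nonneg {n : ℕ} {b : (Fin n → Bool) → ℝ} (hb : ∀ x, 0 ≤ b x) {t : Fin n → ℝ}
    (ht : ∀ i, |t i| ≤ 1) : 0 ≤ likelihood b t :=
  Finset.sum_nonneg fun x _ => mul_nonneg (hb x) <|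
    Finset.prod_nonneg fun i _ => one_add_sgn_mul_nonneg (ht i) _

theorem abs_erasedVal_le (a : Option Bool) : |erasedVal a| ≤ 1 := by
  rcases a with _ | _ | _ <;> simp [erasedVal, sgn]

/-- The prior on the remaining signs after observing the first one. -/
def restPrior {n : ℕ} (b : (Fin (n + 1) → Bool) → ℝ) (u : ℝ) (x : Fin n → Bool) : ℝ :=
  b (Fin.cons true x) * (1 + u) + b (Fin.cons false x) * (1 - u)

theorem restPrior_nonneg {n : ℕ} {b : (Fin (n + 1) → Bool) → ℝ} (hb : ∀ x, 0 ≤ b x) {u : ℝ}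
    (hu : |u| ≤ 1) (x : Fin n → Bool) : 0 ≤ restPrior b u x := by
  rw [abs_le] at hu
  exact add_nonneg (mul_nonneg (hb _) (by linarith)) (mul_nonneg (hb _) (by linarith))

/-- Absorbing the first observation into the (unnormalized) prior keeps the form of the likelihood;
this makes induction on the number of coordinates possible. -/
theorem likelihood_cons {n : ℕ} (b : (Fin (n + 1) → Bool) → ℝ) (u : ℝ) (t : Fin n → ℝ) :
    likelihood b (Fin.cons u t) = likelihood (restPrior b u) t := by
  rw [likelihood, sum_fin_succ_cons, likelihood, Fintype.sum_bool, ← Finset.sum_add_distrib]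
  refine Finset.sum_congr rfl fun x _ => ?_
  simp only [Fin.prod_univ_succ, Fin.cons_zero, Fin.cons_succ, restPrior, sgn]
  simp only [if_true, Bool.false_eq_true, if_false]
  ring

theorem likelihood_cons_affine {n : ℕ} (b : (Fin (n + 1) → Bool) → ℝ) (u : ℝ) (t : Fin n → ℝ) :
    likelihood b (Fin.cons u t) =
      likelihood (fun x => b (Fin.cons true x)) t * (1 + u) +
        likelihood (fun x => b (Fin.cons false x)) t * (1 - u) := by
  rw [likelihood_cons, likelihood, likelihood, likelihood, Finset.sum_mul, Finset.sum_mul,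
    ← Finset.sum_add_distrib]
  refine Finset.sum_congr rfl fun x _ => ?_
  simp only [restPrior]
  ring

theorem chiSqIntegrand_cons {n : ℕ} (b : Bool → (Fin (n + 1) → Bool) → ℝ) (u : ℝ)
    (t : Fin n → ℝ) :
    chiSqIntegrand b (Fin.cons u t) = chiSqIntegrand (fun y => restPrior (b y) u) t := by
  simp only [chiSqIntegrand, likelihood_cons]

theorem chiSqIntegrand_nonneg {n : ℕ} {b : Bool → (Fin n → Bool) → ℝ} (hb : ∀ y x, 0 ≤ b y x)
    {t : Fin n → ℝ} (ht : ∀ i, |t i| ≤ 1) : 0 ≤ chiSqIntegrand b t :=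
  div_nonneg (sq_nonneg _) <|
    div_nonneg (add_nonneg (likelihood_nonneg (hb _) ht) (likelihood_nonneg (hb _) ht)) two_pos.le

/-! ### Symmetric laws against erasure laws -/

/-- The one-coordinate inequality: among symmetric laws with the same second moment, the erasure
law maximizes the mean of a perspective of a square. -/
theorem sq_div_affine_le {a b c e u : ℝ} (hu : |u| ≤ 1) (hp : |a + b| ≤ c + e)
    (hm : |a - b| ≤ c - e) :
    ((a + b * u) ^ 2 / (c + e * u) + (a - b * u) ^ 2 / (c - e * u)) / 2 ≤
      (1 - u ^ 2) * (a ^ 2 / c) +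
        u ^ 2 / 2 * ((a + b) ^ 2 / (c + e) + (a - b) ^ 2 / (c - e)) := by
  have hu2 : u ^ 2 ≤ 1 := by
    rw [← sq_abs]; exact pow_le_one₀ (abs_nonneg u) hu
  have hce : 0 ≤ c + e := (abs_nonneg _).trans hp
  have hce' : 0 ≤ c - e := (abs_nonneg _).trans hm
  rw [abs_le] at hu
  rcases hce.eq_or_lt with h1 | h1
  -- If `c + e = 0`, numerator and denominator vanish together at `u = 1`, the quotient is linear in
  -- `1 - u`, and both sides equal `a ^ 2 / c`. The case `c - e = 0` is its mirror image.
  · have hab : a + b = 0 := by simpa [← h1] using hp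
    obtain rfl : b = -a := by linarith
    obtain rfl : e = -c := by linarith
    have e1 : ∀ v : ℝ, (a * (1 - v)) ^ 2 / (c * (1 - v)) = a ^ 2 / c * (1 - v) := by
      intro v
      by_cases hv : 1 - v = 0
      · simp [hv]
      by_cases hc : c = 0
      · simp [hc]
      field_simp
    have t1 := e1 u
    have t2 := e1 (-u)
    have t3 := e1 (-1)
    have r1 : a + -a * u = a * (1 - u) := by ring
    have r2 : c + -c * u = c * (1 - u) := by ring
    have r3 : a - -a * u = a * (1 - -u) := by ring
    have r4 : c - -c * u = c * (1 - -u) := by ring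
    have r5 : a - -a = a * (1 - -1) := by ring
    have r6 : c - -c = c * (1 - -1) := by ring
    rw [r1, r2, r3, r4, r5, r6, t1, t2, t3]
    simp only [add_neg_cancel, ne_eq, OfNat.ofNat_ne_zero, not_false_eq_true, zero_pow, zero_div]
    apply le_of_eq
    ring
  rcases hce'.eq_or_lt with h2 | h2
  · have hab : a - b = 0 := by simpa [← h2] using hm
    obtain rfl : b = a := by linarith
    obtain rfl : e = c := by linarith
    have e1 : ∀ v : ℝ, (b * (1 - v)) ^ 2 / (e * (1 - v)) = b ^ 2 / e * (1 - v) := by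
      intro v
      by_cases hv : 1 - v = 0
      · simp [hv]
      by_cases hc : e = 0
      · simp [hc]
      field_simp
    have t1 := e1 u
    have t2 := e1 (-u)
    have t3 := e1 (-1)
    have r1 : b + b * u = b * (1 - -u) := by ring
    have r2 : e + e * u = e * (1 - -u) := by ring
    have r3 : b - b * u = b * (1 - u) := by ring
    have r4 : e - e * u = e * (1 - u) := by ring
    have r5 : b + b = b * (1 - -1) := by ring
    have r6 : e + e = e * (1 - -1) := by ring
    rw [r1, r2, r3, r4, r5, r6, t1, t2, t3]
    simp only [sub_self, ne_eq, OfNat.ofNat_ne_zero, not_false_eq_true, zero_pow, zero_div]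
    apply le_of_eq
    ring
  have hc : 0 < c := by linarith
  have k1 : 0 < c + e * u := by
    rcases le_total 0 e with h | h <;> nlinarith
  have k2 : 0 < c - e * u := by
    rcases le_total 0 e with h | h <;> nlinarith
  have k1' : c + u * e ≠ 0 := by rw [mul_comm u]; exact k1.ne'
  have k2' : c - u * e ≠ 0 := by rw [mul_comm u]; exact k2.ne'
  -- The excess of the average over its value at `0` is `u²` times `K / (c² - e²u²)` with `K ≥ 0`
  -- independent of `u`. As `u² ≤ 1`, this quotient is at most its value at `u = 1`, which is what
  -- the erasure law produces.
  have hA : ((a + b * u) ^ 2 / (c + e * u) + (a - b * u) ^ 2 / (c - e * u)) / 2 =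
      a ^ 2 / c + u ^ 2 * ((b * c - a * e) ^ 2 / c / ((c + e * u) * (c - e * u))) := by
    field_simp
    ring
  have hB : ((a + b) ^ 2 / (c + e) + (a - b) ^ 2 / (c - e)) / 2 =
      a ^ 2 / c + (b * c - a * e) ^ 2 / c / ((c + e) * (c - e)) := by
    field_simp
    ring
  have hC : (b * c - a * e) ^ 2 / c / ((c + e * u) * (c - e * u)) ≤
      (b * c - a * e) ^ 2 / c / ((c + e) * (c - e)) := by
    refine div_le_div_of_nonneg_left (by positivity) (mul_pos h1 h2) ?_
    nlinarith [mul_nonneg (sq_nonneg e) (sub_nonneg.2 hu2)]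
  have hD := mul_le_mul_of_nonneg_left hC (sq_nonneg u)
  rw [hA]
  have : (1 - u ^ 2) * (a ^ 2 / c) + u ^ 2 / 2 * ((a + b) ^ 2 / (c + e) + (a - b) ^ 2 / (c - e)) =
      a ^ 2 / c + u ^ 2 * ((b * c - a * e) ^ 2 / c / ((c + e) * (c - e))) := by
    linear_combination u ^ 2 * hB
  rw [this]
  linarith

theorem chiSqIntegrand_cons_symm_le {n : ℕ} {b : Bool → (Fin (n + 1) → Bool) → ℝ}
    (hb : ∀ y x, 0 ≤ b y x) {u : ℝ} (hu : |u| ≤ 1) {t : Fin n → ℝ} (ht : ∀ i, |t i| ≤ 1) :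
    (∑ a : Bool, chiSqIntegrand b (Fin.cons (sgn a * u) t)) / 2 ≤
      ∑ a, erasedWeight (u ^ 2) a * chiSqIntegrand b (Fin.cons (erasedVal a) t) := by
  have l0 : ∀ y z, 0 ≤ likelihood (fun x => b y (Fin.cons z x)) t :=
    fun y z => likelihood_nonneg (fun x => hb _ _) ht
  have h1 := l0 true true
  have h2 := l0 true false
  have h3 := l0 false true
  have h4 := l0 false false
  simp only [Fintype.sum_option, Fintype.sum_bool, erasedWeight, erasedVal, sgn, chiSqIntegrand,
    likelihood_cons_affine, if_true, Bool.false_eq_true, if_false]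
  generalize likelihood (fun x => b true (Fin.cons true x)) t = A at *
  generalize likelihood (fun x => b true (Fin.cons false x)) t = B at *
  generalize likelihood (fun x => b false (Fin.cons true x)) t = C at *
  generalize likelihood (fun x => b false (Fin.cons false x)) t = D at *
  -- The half-difference of the likelihoods is `a + b * u` and their half-sum is `c + e * u`. The
  -- two bounds become `|A - C| ≤ A + C` and `|B - D| ≤ B + D`.
  have key := sq_div_affine_le (a := (A + B - C - D) / 2) (b := (A - B - C + D) / 2)
    (c := (A + B + C + D) / 2) (e := (A - B + C - D) / 2) hu
    (by rw [abs_le]; constructor <;> linarith) (by rw [abs_le]; constructor <;> linarith)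
  convert key using 1
  · congr 3 <;> ring
  · rw [mul_add, add_assoc]
    congr 4 <;> ring

/-- Induction on the coordinates: with the first value fixed, it is absorbed into the prior and the
tail is replaced by erased signs; the one-coordinate inequality is then applied to the first
coordinate for each erased tail. -/
theorem symmetrized_le_erased {n : ℕ} {b : Bool → (Fin n → Bool) → ℝ}
    (hb : ∀ y x, 0 ≤ b y x) {t : Fin n → ℝ} (ht : ∀ i, |t i| ≤ 1) :
    (∑ s : Fin n → Bool, chiSqIntegrand b fun i => sgn (s i) * t i) / 2 ^ n ≤
      ∑ w : Fin n → Option Bool,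
        (∏ i, erasedWeight (t i ^ 2) (w i)) * chiSqIntegrand b fun i => erasedVal (w i) := by
  induction n with
  | zero =>
    simp only [Finset.univ_unique, Finset.sum_singleton, Finset.univ_eq_empty, Finset.prod_empty,
      pow_zero, div_one, one_mul]
    exact le_of_eq (congrArg _ (Subsingleton.elim _ _))
  | succ n ih =>
    have c1 : ∀ (a : Bool) (s : Fin n → Bool),
        (fun i => sgn ((Fin.cons a s : Fin (n + 1) → Bool) i) * t i) =
          Fin.cons (sgn a * t 0) fun i => sgn (s i) * t i.succ := by
      intro a s
      ext i
      refine Fin.cases ?_ (fun i => ?_) i <;> simp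
    have c2 : ∀ (a : Option Bool) (s : Fin n → Option Bool),
        (fun i => erasedVal ((Fin.cons a s : Fin (n + 1) → Option Bool) i)) =
          Fin.cons (erasedVal a) fun i => erasedVal (s i) := by
      intro a s
      ext i
      refine Fin.cases ?_ (fun i => ?_) i <;> simp
    rw [sum_fin_succ_cons, sum_fin_succ_cons]
    simp only [c1, c2, Fin.prod_univ_succ, Fin.cons_zero, Fin.cons_succ]
    have step1 : ∀ a : Bool,
        (∑ s : Fin n → Bool,
          chiSqIntegrand b (Fin.cons (sgn a * t 0) fun i => sgn (s i) * t i.succ)) / 2 ^ n ≤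
        ∑ w : Fin n → Option Bool, (∏ i, erasedWeight (t i.succ ^ 2) (w i)) *
          chiSqIntegrand b (Fin.cons (sgn a * t 0) fun i => erasedVal (w i)) := by
      intro a
      simp only [chiSqIntegrand_cons]
      exact ih (fun y x => restPrior_nonneg (hb y) (by rw [abs_sgn_mul]; exact ht 0) x)
        fun i => ht i.succ
    calc _ = (∑ a : Bool, (∑ s : Fin n → Bool,
          chiSqIntegrand b (Fin.cons (sgn a * t 0) fun i => sgn (s i) * t i.succ)) / 2 ^ n) / 2 := by
          rw [← Finset.sum_div, pow_succ, div_div]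
      _ ≤ (∑ a : Bool, ∑ w : Fin n → Option Bool, (∏ i, erasedWeight (t i.succ ^ 2) (w i)) *
          chiSqIntegrand b (Fin.cons (sgn a * t 0) fun i => erasedVal (w i))) / 2 := by
          gcongr with a
          exact step1 a
      _ = ∑ w : Fin n → Option Bool, (∏ i, erasedWeight (t i.succ ^ 2) (w i)) *
          ((∑ a : Bool,
            chiSqIntegrand b (Fin.cons (sgn a * t 0) fun i => erasedVal (w i))) / 2) := by
          rw [Finset.sum_comm, Finset.sum_div]
          refine Finset.sum_congr rfl fun w _ => ?_
          rw [← Finset.mul_sum, mul_div_assoc]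
      _ ≤ ∑ w : Fin n → Option Bool, (∏ i, erasedWeight (t i.succ ^ 2) (w i)) *
          ∑ a, erasedWeight (t 0 ^ 2) a *
            chiSqIntegrand b (Fin.cons (erasedVal a) fun i => erasedVal (w i)) := by
          gcongr with w
          · refine Finset.prod_nonneg fun i _ => erasedWeight_nonneg (sq_nonneg _) ?_ _
            rw [← sq_abs]
            exact pow_le_one₀ (abs_nonneg _) (ht _)
          · exact chiSqIntegrand_cons_symm_le hb (ht 0) fun i => abs_erasedVal_le _
      _ = _ := by
          simp only [Finset.mul_sum]
          rw [Finset.sum_comm]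
          refine Finset.sum_congr rfl fun a _ => Finset.sum_congr rfl fun w _ => ?_
          ring

/-- For erased signs the symmetrization inequality is an equality. -/
theorem symmetrized_eq_erased {n : ℕ} (H : (Fin n → ℝ) → ℝ) {t : Fin n → ℝ}
    (ht : ∀ i, t i = 0 ∨ |t i| = 1) :
    (∑ s : Fin n → Bool, H fun i => sgn (s i) * t i) / 2 ^ n =
      ∑ w : Fin n → Option Bool,
        (∏ i, erasedWeight (t i ^ 2) (w i)) * H fun i => erasedVal (w i) := by
  induction n with
  | zero =>
    simp only [Finset.univ_unique, Finset.sum_singleton, Finset.univ_eq_empty, Finset.prod_empty,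
      pow_zero, div_one, one_mul]
    exact congrArg _ (Subsingleton.elim _ _)
  | succ n ih =>
    have c1 : ∀ (a : Bool) (s : Fin n → Bool),
        (fun i => sgn ((Fin.cons a s : Fin (n + 1) → Bool) i) * t i) =
          Fin.cons (sgn a * t 0) fun i => sgn (s i) * t i.succ := by
      intro a s
      ext i
      refine Fin.cases ?_ (fun i => ?_) i <;> simp
    have c2 : ∀ (a : Option Bool) (s : Fin n → Option Bool),
        (fun i => erasedVal ((Fin.cons a s : Fin (n + 1) → Option Bool) i)) =
          Fin.cons (erasedVal a) fun i => erasedVal (s i) := by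
      intro a s
      ext i
      refine Fin.cases ?_ (fun i => ?_) i <;> simp
    rw [sum_fin_succ_cons, sum_fin_succ_cons]
    simp only [c1, c2, Fin.prod_univ_succ, Fin.cons_zero, Fin.cons_succ]
    set S : ℝ → ℝ := fun v => ∑ w : Fin n → Option Bool,
      (∏ i, erasedWeight (t i.succ ^ 2) (w i)) * H (Fin.cons v fun i => erasedVal (w i)) with hS
    have hsymm : ∀ v : ℝ, (∑ s : Fin n → Bool,
        H (Fin.cons v fun i => sgn (s i) * t i.succ)) = 2 ^ n * S v := by
      intro v
      simp only [hS]
      rw [← ih (fun z => H (Fin.cons v z)) fun i => ht i.succ]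
      field_simp
    have herased : ∀ a : Option Bool, (∑ w : Fin n → Option Bool,
        (erasedWeight (t 0 ^ 2) a * ∏ i, erasedWeight (t i.succ ^ 2) (w i)) *
          H (Fin.cons (erasedVal a) fun i => erasedVal (w i))) =
        erasedWeight (t 0 ^ 2) a * S (erasedVal a) := by
      intro a
      simp only [hS, mul_assoc, ← Finset.mul_sum]
    simp only [hsymm, herased]
    clear_value S
    simp only [Fintype.sum_bool, Fintype.sum_option, erasedWeight, erasedVal, sgn, if_true,
      Bool.false_eq_true, if_false, pow_succ]
    -- A symmetric sign times `0` is the point mass at `0`, and a symmetric sign times `±1` is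
    -- uniform on `{1, -1}`: both are already the erasure law of the same second moment.
    rcases ht 0 with h | h
    · rw [h]
      field_simp
      simp
      ring
    · rcases eq_or_eq_neg_of_abs_eq h with h | h
      · rw [h]
        field_simp
        simp
      · rw [h]
        field_simp
        simp
        ring

/-! ### BMS channels as odd correlation functions -/

/-- `P x` has density `1 ± h` with respect to the output law `Q`, and `h` is odd for the
involution `σ`, which preserves `Q`. -/
structure HasCorrelation {Y : Type*} [MeasurableSpace Y] (P : Kernel Bool Y) (σ : Y → Y)
    (Q : Measure Y) (h : Y → ℝ) : Prop where
  prob : IsProbabilityMeasure Q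
  measurable : Measurable h
  abs_le_one : ∀ y, |h y| ≤ 1
  involutive : Function.Involutive σ
  odd : ∀ y, h (σ y) = -h y
  preserving : MeasurePreserving σ Q Q
  eq_withDensity : ∀ x, P x = Q.withDensity fun y => ENNReal.ofReal (1 + sgn x * h y)

section Correlation

variable {Y : Type*} [MeasurableSpace Y]

theorem withDensity_map_of_preserving {Q : Measure Y} {σ : Y → Y} (hσ : MeasurePreserving σ Q Q)
    (hinv : Function.Involutive σ) {f : Y → ℝ≥0∞} (hf : Measurable f) :
    (Q.withDensity f).map σ = Q.withDensity (f ∘ σ) := by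
  ext s hs
  rw [Measure.map_apply hσ.measurable hs, withDensity_apply _ (hσ.measurable hs),
    withDensity_apply _ hs]
  conv_rhs => rw [← hσ.map_eq]
  rw [setLIntegral_map hs (hf.comp hσ.measurable) hσ.measurable]
  exact lintegral_congr fun y => by simp [hinv y]

theorem HasCorrelation.isBMS {P : Kernel Bool Y} [IsMarkovKernel P] {σ : Y → Y} {Q : Measure Y}
    {h : Y → ℝ} (hc : HasCorrelation P σ Q h) : IsBMS P := by
  refine ⟨σ, inferInstance, hc.preserving.measurable, hc.involutive, fun E hE => ?_⟩
  have hm := hc.measurable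
  rw [hc.involutive.image_eq_preimage_symm, ← Measure.map_apply hc.preserving.measurable hE,
    hc.eq_withDensity, hc.eq_withDensity,
    withDensity_map_of_preserving hc.preserving hc.involutive (by fun_prop)]
  simp [Function.comp_def, hc.odd, sgn]

/-- Take `Q` to be the average of `P true` and `P false`, which `σ` exchanges, and `h` the density
of `P true` minus `1`. The work lies in choosing a version of `h` that is bounded and odd
everywhere, not just almost everywhere. -/
theorem IsBMSWith.exists_hasCorrelation {P : Kernel Bool Y} {σ : Y → Y} (hP : IsBMSWith P σ) :
    ∃ (Q : Measure Y) (h : Y → ℝ), HasCorrelation P σ Q h := by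
  have := hP.markov
  have hσ := hP.measurable
  have hinv := hP.involutive
  have hmap : (P false).map σ = P true := by
    ext E hE
    rw [Measure.map_apply hσ hE, hP.symm E hE, hinv.image_eq_preimage_symm]
  have hmap' : (P true).map σ = P false := by
    rw [← hmap, Measure.map_map hσ hσ, hinv.comp_self, Measure.map_id]
  set Q : Measure Y := (2 : ℝ≥0∞)⁻¹ • (P true + P false) with hQ
  have hprob : IsProbabilityMeasure Q := by
    constructor
    simp only [hQ, Measure.smul_apply, Measure.add_apply, measure_univ, smul_eq_mul]
    rw [one_add_one_eq_two]
    exact ENNReal.inv_mul_cancel (by simp) (by simp)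
  have hpres : MeasurePreserving σ Q Q := by
    refine ⟨hσ, ?_⟩
    rw [hQ, Measure.map_smul, Measure.map_add _ _ hσ, hmap, hmap', add_comm]
  have h2Q : P true + P false = (2 : ℝ≥0∞) • Q := by
    rw [hQ, smul_smul, ENNReal.mul_inv_cancel (by simp) (by simp), one_smul]
  have hle : P true ≤ (2 : ℝ≥0∞) • Q := h2Q ▸ Measure.le_add_right le_rfl
  have hac : P true ≪ Q :=
    (Measure.absolutelyContinuous_of_le hle).trans Measure.smul_absolutelyContinuous
  -- Since `P true ≤ 2 • Q`, the derivative is at most `2` almost everywhere, so the truncation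
  -- changes only a null set.
  set g : Y → ℝ := fun y => max (-1) (min 1 (((P true).rnDeriv Q y).toReal - 1)) with hg
  have hgm : Measurable g := by fun_prop
  have hg1 : ∀ y, |g y| ≤ 1 := fun y => by
    rw [abs_le]
    exact ⟨le_max_left _ _, max_le (by norm_num) (min_le_left _ _)⟩
  have hrn2 : (P true).rnDeriv Q ≤ᵐ[Q] fun _ => 2 := by
    refine ae_le_of_forall_setLIntegral_le_of_sigmaFinite (Measure.measurable_rnDeriv _ _)
      fun s hs _ => ?_
    calc _ ≤ P true s := Measure.setLIntegral_rnDeriv_le s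
      _ ≤ ((2 : ℝ≥0∞) • Q) s := hle s
      _ = _ := by simp
  have htrue : P true = Q.withDensity fun y => ENNReal.ofReal (1 + g y) := by
    conv_lhs => rw [← Measure.withDensity_rnDeriv_eq _ _ hac]
    refine withDensity_congr_ae ?_
    filter_upwards [hrn2] with y hy
    have h1 : ((P true).rnDeriv Q y).toReal ≤ 2 := ENNReal.toReal_le_of_le_ofReal (by norm_num)
      (by simpa using hy)
    have h2 : 0 ≤ ((P true).rnDeriv Q y).toReal := ENNReal.toReal_nonneg
    have h3 : g y = ((P true).rnDeriv Q y).toReal - 1 := by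
      simp only [hg]
      rw [min_eq_right (by linarith), max_eq_right (by linarith)]
    rw [h3, add_sub_cancel, ENNReal.ofReal_toReal (ne_top_of_le_ne_top (by simp) hy)]
  have hfalse : P false = Q.withDensity fun y => ENNReal.ofReal (1 + g (σ y)) := by
    rw [← hmap', htrue, withDensity_map_of_preserving hpres hinv (by fun_prop)]
    rfl
  have hn : ∀ y, 0 ≤ 1 + g y := fun y => by linarith [(abs_le.1 (hg1 y)).1]
  have hn' : ∀ y, 0 ≤ 1 - g y := fun y => by linarith [(abs_le.1 (hg1 y)).2]
  -- The densities `1 + g` and `1 + g ∘ σ` of the two conditional laws add up to `2`.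
  have hsum : ∀ᵐ y ∂Q, g y + g (σ y) = 0 := by
    have e1 : Q.withDensity (fun y => ENNReal.ofReal (2 + (g y + g (σ y)))) =
        Q.withDensity fun _ => 2 := by
      rw [withDensity_const, ← h2Q, htrue, hfalse, ← withDensity_add_left (by fun_prop)]
      congr 1
      ext y
      rw [Pi.add_apply, ← ENNReal.ofReal_add (hn _) (hn _)]
      congr 1
      ring
    have e2 := (withDensity_eq_iff_of_sigmaFinite (by fun_prop) (by fun_prop)).1 e1
    filter_upwards [e2] with y hy
    have := congrArg ENNReal.toReal hy
    rw [ENNReal.toReal_ofReal (by linarith [hn y, hn (σ y)])] at this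
    simp at this
    linarith
  -- Antisymmetrizing makes oddness exact at every point and changes `g` only on a null set.
  set h : Y → ℝ := fun y => (g y - g (σ y)) / 2 with hh
  have hhg : ∀ᵐ y ∂Q, h y = g y ∧ g (σ y) = -g y := by
    filter_upwards [hsum] with y hy
    simp only [hh]
    constructor <;> linarith
  refine ⟨Q, h, hprob, by fun_prop, fun y => ?_, hinv, fun y => ?_, hpres, fun x => ?_⟩
  · have h1 := abs_le.1 (hg1 y)
    have h2 := abs_le.1 (hg1 (σ y))
    simp only [hh]
    rw [abs_le]
    constructor <;> linarith
  · simp only [hh, hinv y]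
    ring
  · cases x
    · rw [hfalse]
      refine withDensity_congr_ae ?_
      filter_upwards [hhg] with y hy
      rw [hy.1, hy.2]
      simp [sgn]
    · rw [htrue]
      refine withDensity_congr_ae ?_
      filter_upwards [hhg] with y hy
      rw [hy.1]
      simp [sgn]

theorem HasCorrelation.integrable_sq {P : Kernel Bool Y} {σ : Y → Y} {Q : Measure Y}
    {h : Y → ℝ} (hc : HasCorrelation P σ Q h) : Integrable (fun y => h y ^ 2) Q := by
  have := hc.prob
  have := hc.measurable
  refine Integrable.of_bound (by fun_prop) 1 (Filter.Eventually.of_forall fun y => ?_)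
  rw [norm_pow]
  exact pow_le_one₀ (norm_nonneg _) (hc.abs_le_one y)

/-- The densities `1 + h` and `1 - h` have half-difference `h` and half-sum `1`. -/
theorem HasCorrelation.chiSqCapacity_eq {P : Kernel Bool Y} [IsMarkovKernel P] {σ : Y → Y}
    {Q : Measure Y} {h : Y → ℝ} (hc : HasCorrelation P σ Q h) :
    chiSqCapacity P = ENNReal.ofReal (∫ y, h y ^ 2 ∂Q) := by
  have := hc.prob
  have hm := hc.measurable
  rw [chiSqCapacity_eq_lintegral P Q (fun x y => 1 + sgn x * h y) (fun x => by fun_prop)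
    (fun x y => one_add_sgn_mul_nonneg (hc.abs_le_one y) x) hc.eq_withDensity,
    ofReal_integral_eq_lintegral_ofReal hc.integrable_sq
      (Filter.Eventually.of_forall fun y => sq_nonneg _)]
  refine lintegral_congr fun y => ?_
  simp only [sgn, if_true, Bool.false_eq_true, if_false]
  congr 1
  ring

theorem HasCorrelation.integral_sq_le_one {P : Kernel Bool Y} {σ : Y → Y} {Q : Measure Y}
    {h : Y → ℝ} (hc : HasCorrelation P σ Q h) : ∫ y, h y ^ 2 ∂Q ≤ 1 := by
  have := hc.prob
  calc ∫ y, h y ^ 2 ∂Q ≤ ∫ _, (1 : ℝ) ∂Q := by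
        refine integral_mono hc.integrable_sq (integrable_const _) fun y => ?_
        rw [← sq_abs]
        exact pow_le_one₀ (abs_nonneg _) (hc.abs_le_one y)
    _ = 1 := by simp

/-! ### Broadcasting through a BMS channel and extremality of erasures -/

/-- A product of measures with densities has the product density. -/
theorem pi_withDensity_ofReal {n : ℕ} (Q : Measure Y) [IsFiniteMeasure Q] (f : Fin n → Y → ℝ)
    (h0 : ∀ i y, 0 ≤ f i y) (hint : ∀ i, Integrable (f i) Q) :
    Measure.pi (fun i => Q.withDensity fun y => ENNReal.ofReal (f i y)) =
      (Measure.pi fun _ => Q).withDensity fun y => ENNReal.ofReal (∏ i, f i (y i)) := by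
  have hfin : ∀ i, IsFiniteMeasure (Q.withDensity fun y => ENNReal.ofReal (f i y)) :=
    fun i => isFiniteMeasure_withDensity_ofReal (hint i).2
  refine Measure.pi_eq fun s hs => ?_
  rw [withDensity_apply _ (MeasurableSet.univ_pi hs), Measure.restrict_pi_pi,
    ← ofReal_integral_eq_lintegral_ofReal, integral_fintype_prod_eq_prod,
    ENNReal.ofReal_prod_of_nonneg]
  · refine Finset.prod_congr rfl fun i _ => ?_
    rw [withDensity_apply _ (hs i), ofReal_integral_eq_lintegral_ofReal (hint i).integrableOn
      (Filter.Eventually.of_forall (h0 i))]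
  · exact fun i _ => integral_nonneg (h0 i)
  · exact Integrable.fintype_prod_dep fun i => (hint i).integrableOn
  · exact Filter.Eventually.of_forall fun y => Finset.prod_nonneg fun i _ => h0 i _

theorem HasCorrelation.tensorPow_apply {P : Kernel Bool Y} {σ : Y → Y} {Q : Measure Y}
    {h : Y → ℝ} (hc : HasCorrelation P σ Q h) {n : ℕ} (x : Fin n → Bool) :
    tensorPow P n x = (Measure.pi fun _ => Q).withDensity
      fun y => ENNReal.ofReal (∏ i, (1 + sgn (x i) * h (y i))) := by
  have := hc.prob
  have hm := hc.measurable
  rw [← pi_withDensity_ofReal Q (fun i y => 1 + sgn (x i) * h y)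
    (fun i y => one_add_sgn_mul_nonneg (hc.abs_le_one y) _)]
  · change Measure.pi (fun i => P (x i)) = _
    simp_rw [hc.eq_withDensity]
  · intro i
    refine Integrable.of_bound (by fun_prop) 2 (Filter.Eventually.of_forall fun y => ?_)
    calc ‖1 + sgn (x i) * h y‖ ≤ ‖(1 : ℝ)‖ + ‖sgn (x i) * h y‖ := norm_add_le _ _
      _ ≤ 1 + 1 := by
        gcongr
        · simp
        · rw [Real.norm_eq_abs, abs_sgn_mul]
          exact hc.abs_le_one y
      _ = 2 := by norm_num

/-- The transition probabilities of a channel with finite output alphabet. -/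
noncomputable def transition {X : Type*} [MeasurableSpace X] (B : Kernel Bool X) (y : Bool)
    (x : X) : ℝ :=
  (B y).real {x}

theorem transition_nonneg {X : Type*} [MeasurableSpace X] (B : Kernel Bool X) (y : Bool)
    (x : X) : 0 ≤ transition B y x :=
  measureReal_nonneg

@[fun_prop]
theorem measurable_likelihood {n : ℕ} (b : (Fin n → Bool) → ℝ) : Measurable (likelihood b) := by
  unfold likelihood
  fun_prop

@[fun_prop]
theorem measurable_chiSqIntegrand {n : ℕ} (b : Bool → (Fin n → Bool) → ℝ) :
    Measurable (chiSqIntegrand b) := by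
  unfold chiSqIntegrand
  fun_prop

theorem HasCorrelation.comp_apply {P : Kernel Bool Y} {σ : Y → Y} {Q : Measure Y}
    {h : Y → ℝ} (hc : HasCorrelation P σ Q h) {n : ℕ} (B : Kernel Bool (Fin n → Bool))
    [IsMarkovKernel B] (y : Bool) :
    (tensorPow P n ∘ₖ B) y = (Measure.pi fun _ => Q).withDensity
      fun z => ENNReal.ofReal (likelihood (transition B y) fun i => h (z i)) := by
  have := hc.prob
  have hm := hc.measurable
  ext s hs
  rw [Kernel.comp_apply' _ _ _ hs, lintegral_fintype, withDensity_apply _ hs]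
  simp only [hc.tensorPow_apply, withDensity_apply _ hs, likelihood]
  have hn : ∀ (x : Fin n → Bool) (z : Fin n → Y), 0 ≤ ∏ i, (1 + sgn (x i) * h (z i)) :=
    fun x z => Finset.prod_nonneg fun i _ => one_add_sgn_mul_nonneg (hc.abs_le_one _) _
  simp_rw [ENNReal.ofReal_sum_of_nonneg fun x _ => mul_nonneg (transition_nonneg B y x) (hn x _)]
  rw [lintegral_finsetSum _ fun x _ => by fun_prop]
  refine Finset.sum_congr rfl fun x _ => ?_
  simp_rw [ENNReal.ofReal_mul (transition_nonneg B y x)]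
  rw [lintegral_const_mul _ (by fun_prop), mul_comm]
  congr 1
  exact (ofReal_measureReal).symm

/-- The mean of the `χ²` integrand over independent erased signs with erasure probability
`1 - u`. -/
noncomputable def erasedMean {n : ℕ} (b : Bool → (Fin n → Bool) → ℝ) (u : ℝ) : ℝ :=
  ∑ w : Fin n → Option Bool,
    (∏ i, erasedWeight u (w i)) * chiSqIntegrand b fun i => erasedVal (w i)

instance isMarkovKernel_tensorPow (P : Kernel Bool Y) [IsMarkovKernel P] (n : ℕ) :
    IsMarkovKernel (tensorPow P n) :=
  ⟨fun x => by
    change IsProbabilityMeasure (Measure.pi fun i => P (x i))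
    infer_instance⟩

/-- The capacity as the integral of the symmetrized integrand. -/
theorem HasCorrelation.chiSqCapacity_comp {P : Kernel Bool Y} [IsMarkovKernel P] {σ : Y → Y}
    {Q : Measure Y} {h : Y → ℝ} (hc : HasCorrelation P σ Q h) {n : ℕ}
    (B : Kernel Bool (Fin n → Bool)) [IsMarkovKernel B] :
    chiSqCapacity (tensorPow P n ∘ₖ B) =
      ∫⁻ z, ENNReal.ofReal ((∑ s : Fin n → Bool, chiSqIntegrand (transition B)
        fun i => sgn (s i) * h (z i)) / 2 ^ n) ∂(Measure.pi fun _ => Q) := by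
  have := hc.prob
  have hm := hc.measurable
  have hG : ∀ (s : Fin n → Bool) (z : Fin n → Y),
      0 ≤ chiSqIntegrand (transition B) fun i => sgn (s i) * h (z i) := fun s z =>
    chiSqIntegrand_nonneg (transition_nonneg B) fun i => by
      rw [abs_sgn_mul]; exact hc.abs_le_one _
  have hcap : chiSqCapacity (tensorPow P n ∘ₖ B) =
      ∫⁻ z, ENNReal.ofReal (chiSqIntegrand (transition B) fun i => h (z i))
        ∂(Measure.pi fun _ => Q) :=
    chiSqCapacity_eq_lintegral _ _
      (fun y (z : Fin n → Y) => likelihood (transition B y) fun i => h (z i))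
      (fun y => by fun_prop)
      (fun y z => likelihood_nonneg (transition_nonneg B y) fun i => hc.abs_le_one _)
      (hc.comp_apply B)
  have hflip : ∀ s : Fin n → Bool,
      ∫⁻ z, ENNReal.ofReal (chiSqIntegrand (transition B) fun i => sgn (s i) * h (z i))
        ∂(Measure.pi fun _ => Q) = chiSqCapacity (tensorPow P n ∘ₖ B) := by
    intro s
    -- Applying `σ` exactly in the coordinates where the sign is negative preserves the product law
    -- and multiplies each `h (z i)` by `sgn (s i)`.
    have hpres : MeasurePreserving (fun (z : Fin n → Y) i => (if s i then id else σ) (z i))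
        (Measure.pi fun _ => Q) (Measure.pi fun _ => Q) := by
      refine measurePreserving_pi _ _ fun i => ?_
      by_cases hs : s i
      · simpa [hs] using MeasurePreserving.id Q
      · simpa [hs] using hc.preserving
    rw [hcap, ← hpres.lintegral_comp (by fun_prop)]
    refine lintegral_congr fun z => ?_
    congr 2
    ext i
    cases hs : s i <;> simp [sgn, hs, hc.odd]
  have hsum : ∀ z : Fin n → Y, ENNReal.ofReal ((∑ s : Fin n → Bool, chiSqIntegrand (transition B)
        fun i => sgn (s i) * h (z i)) / 2 ^ n) =
      ENNReal.ofReal ((2 ^ n)⁻¹) * ∑ s : Fin n → Bool,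
        ENNReal.ofReal (chiSqIntegrand (transition B) fun i => sgn (s i) * h (z i)) := by
    intro z
    rw [← ENNReal.ofReal_sum_of_nonneg fun s _ => hG s z, ← ENNReal.ofReal_mul (by positivity),
      div_eq_inv_mul]
  simp_rw [hsum]
  rw [lintegral_const_mul _ (by fun_prop), lintegral_finsetSum _ fun s _ => by fun_prop]
  simp_rw [hflip]
  rw [Finset.sum_const, Finset.card_univ, nsmul_eq_mul, ← mul_assoc]
  simp only [Fintype.card_pi, Fintype.card_bool, Finset.prod_const, Finset.card_univ,
    Fintype.card_fin]
  rw [ENNReal.ofReal_inv_of_pos (by positivity), ENNReal.ofReal_pow (by norm_num)]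
  simp only [ENNReal.ofReal_ofNat, Nat.cast_pow, Nat.cast_ofNat]
  rw [ENNReal.inv_mul_cancel (by simp) (by simp), one_mul]

/-- The integral of the erased mean. -/
theorem HasCorrelation.lintegral_erased {P : Kernel Bool Y} {σ : Y → Y}
    {Q : Measure Y} {h : Y → ℝ} (hc : HasCorrelation P σ Q h) {n : ℕ}
    {b : Bool → (Fin n → Bool) → ℝ} (hb : ∀ y x, 0 ≤ b y x) :
    ∫⁻ z, ENNReal.ofReal (∑ w : Fin n → Option Bool,
        (∏ i, erasedWeight (h (z i) ^ 2) (w i)) * chiSqIntegrand b fun i => erasedVal (w i))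
        ∂(Measure.pi fun _ => Q) = ENNReal.ofReal (erasedMean b (∫ y, h y ^ 2 ∂Q)) := by
  have := hc.prob
  have hm := hc.measurable
  have hsq : ∀ y, h y ^ 2 ≤ 1 := fun y => by
    rw [← sq_abs]; exact pow_le_one₀ (abs_nonneg _) (hc.abs_le_one y)
  -- The weights are affine in the second moment, so averaging them over `Q` only replaces `h y ^ 2`
  -- by its mean; independence then handles the products.
  have hw : ∀ a : Option Bool, Integrable (fun y => erasedWeight (h y ^ 2) a) Q ∧
      ∫ y, erasedWeight (h y ^ 2) a ∂Q = erasedWeight (∫ y, h y ^ 2 ∂Q) a := by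
    rintro (_ | a)
    · refine ⟨(integrable_const _).sub hc.integrable_sq, ?_⟩
      simp only [erasedWeight]
      rw [integral_sub (integrable_const _) hc.integrable_sq]
      simp
    · exact ⟨hc.integrable_sq.div_const _, integral_div _ _⟩
  have hint : ∀ w : Fin n → Option Bool, Integrable (fun z : Fin n → Y =>
      ∏ i, erasedWeight (h (z i) ^ 2) (w i)) (Measure.pi fun _ => Q) := fun w =>
    Integrable.fintype_prod_dep (f := fun i y => erasedWeight (h y ^ 2) (w i))
      fun i => (hw (w i)).1
  rw [← ofReal_integral_eq_lintegral_ofReal]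
  · rw [integral_finsetSum _ fun w _ => (hint w).mul_const _, erasedMean]
    congr 1
    refine Finset.sum_congr rfl fun w _ => ?_
    rw [integral_mul_const]
    congr 1
    rw [integral_fintype_prod_eq_prod (fun i y => erasedWeight (h y ^ 2) (w i))]
    exact Finset.prod_congr rfl fun i _ => (hw (w i)).2
  · exact integrable_finsetSum _ fun w _ => (hint w).mul_const _
  · refine Filter.Eventually.of_forall fun z => Finset.sum_nonneg fun w _ => mul_nonneg ?_ ?_
    · exact Finset.prod_nonneg fun i _ => erasedWeight_nonneg (sq_nonneg _) (hsq _) _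
    · exact chiSqIntegrand_nonneg hb fun i => abs_erasedVal_le _

/-- Erasure channels maximize the capacity among symmetric channels of given capacity. -/
theorem HasCorrelation.chiSqCapacity_comp_le {P : Kernel Bool Y} [IsMarkovKernel P] {σ : Y → Y}
    {Q : Measure Y} {h : Y → ℝ} (hc : HasCorrelation P σ Q h) {n : ℕ}
    (B : Kernel Bool (Fin n → Bool)) [IsMarkovKernel B] :
    chiSqCapacity (tensorPow P n ∘ₖ B) ≤
      ENNReal.ofReal (erasedMean (transition B) (∫ y, h y ^ 2 ∂Q)) := by
  rw [hc.chiSqCapacity_comp B, ← hc.lintegral_erased (transition_nonneg B)]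
  exact lintegral_mono fun z => ENNReal.ofReal_le_ofReal <|
    symmetrized_le_erased (transition_nonneg B) fun i => hc.abs_le_one _

theorem HasCorrelation.chiSqCapacity_comp_eq {P : Kernel Bool Y} [IsMarkovKernel P] {σ : Y → Y}
    {Q : Measure Y} {h : Y → ℝ} (hc : HasCorrelation P σ Q h)
    (hv : ∀ y, h y = 0 ∨ |h y| = 1) {n : ℕ} (B : Kernel Bool (Fin n → Bool)) [IsMarkovKernel B] :
    chiSqCapacity (tensorPow P n ∘ₖ B) =
      ENNReal.ofReal (erasedMean (transition B) (∫ y, h y ^ 2 ∂Q)) := by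
  rw [hc.chiSqCapacity_comp B, ← hc.lintegral_erased (transition_nonneg B)]
  refine lintegral_congr fun z => ?_
  rw [symmetrized_eq_erased _ fun i => hv _]

end Correlation

/-- Serves to transport the erasure channel to a copy of its alphabet in the universe over which
`multiCoeff` ranges. -/
theorem HasCorrelation.map {Y Z : Type*} [MeasurableSpace Y] [MeasurableSpace Z]
    {P : Kernel Bool Y} {σ : Y → Y} {Q : Measure Y} {h : Y → ℝ} (hc : HasCorrelation P σ Q h)
    (e : Y ≃ᵐ Z) :
    HasCorrelation (P.map e) (e ∘ σ ∘ e.symm) (Q.map e) (h ∘ e.symm) := by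
  have := hc.prob
  have hm := hc.measurable
  have he := e.measurable
  have hes := e.symm.measurable
  have hQ : MeasurePreserving e Q (Q.map e) := ⟨he, rfl⟩
  have hQ' : MeasurePreserving e.symm (Q.map e) Q := hQ.symm e
  refine ⟨Measure.isProbabilityMeasure_map he.aemeasurable, by fun_prop,
    fun y => hc.abs_le_one _, fun y => ?_, fun y => ?_,
    hQ.comp (hc.preserving.comp hQ'), fun x => ?_⟩
  · simp [hc.involutive _]
  · simp [hc.odd]
  · rw [Kernel.map_apply _ he, hc.eq_withDensity]
    ext s hs
    rw [Measure.map_apply he hs, withDensity_apply _ (he hs), withDensity_apply _ hs,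
      setLIntegral_map hs (by fun_prop) he]
    simp

/-! ### The binary erasure channel -/

instance : DiscreteMeasurableSpace ErasureOutput := ⟨fun _ => trivial⟩

/-- The sign flip on the output alphabet of an erasure channel. -/
def erasureFlip : ErasureOutput → ErasureOutput
  | .sign x => .sign (!x)
  | .erased => .erased

/-- The correlation of the input of an erasure channel with its output. -/
def erasureVal : ErasureOutput → ℝ
  | .sign x => sgn x
  | .erased => 0

/-- The output law of an erasure channel under a uniform input. -/
noncomputable def erasureLaw (u : ℝ) : Measure ErasureOutput :=
  ENNReal.ofReal (u / 2) • (Measure.dirac (.sign true) + Measure.dirac (.sign false)) +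
    ENNReal.ofReal (1 - u) • Measure.dirac .erased

theorem isMarkovKernel_bec {u : ℝ} (h0 : 0 ≤ u) (h1 : u ≤ 1) : IsMarkovKernel (bec (1 - u)) := by
  refine ⟨fun x => ⟨?_⟩⟩
  change (ENNReal.ofReal (1 - (1 - u)) • Measure.dirac (ErasureOutput.sign x) +
      ENNReal.ofReal (1 - u) • Measure.dirac ErasureOutput.erased) Set.univ = 1
  simp only [Measure.add_apply, Measure.smul_apply, measure_univ, smul_eq_mul, mul_one]
  rw [← ENNReal.ofReal_add (by linarith) (by linarith)]
  simp

/-- For input `x`, the density `1 + sgn x * erasureVal` is `2` at the sign `x`, `0` at the opposite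
sign and `1` at the erasure, turning the masses `u/2, u/2, 1 - u` into `u, 0, 1 - u`. -/
theorem hasCorrelation_bec {u : ℝ} (h0 : 0 ≤ u) (h1 : u ≤ 1) :
    HasCorrelation (bec (1 - u)) erasureFlip (erasureLaw u) erasureVal := by
  have hinv : Function.Involutive erasureFlip := by
    rintro (x | _) <;> simp [erasureFlip]
  refine ⟨⟨?_⟩, .of_discrete, ?_, hinv, ?_, ⟨.of_discrete, ?_⟩, fun x => ?_⟩
  · simp only [erasureLaw, Measure.add_apply, Measure.smul_apply, measure_univ, smul_eq_mul,
      mul_one, one_add_one_eq_two]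
    rw [mul_comm, ← ENNReal.ofReal_ofNat 2, ← ENNReal.ofReal_mul (by norm_num),
      ← ENNReal.ofReal_add (by linarith) (by linarith)]
    ring_nf
    simp
  · rintro (x | _)
    · cases x <;> simp [erasureVal, sgn]
    · simp [erasureVal]
  · rintro (x | _)
    · cases x <;> simp [erasureVal, erasureFlip, sgn]
    · simp [erasureVal, erasureFlip]
  · have hm : Measurable erasureFlip := .of_discrete
    rw [erasureLaw, Measure.map_add _ _ hm, Measure.map_smul, Measure.map_smul,
      Measure.map_add _ _ hm, Measure.map_dirac' hm, Measure.map_dirac' hm, Measure.map_dirac' hm]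
    simp only [erasureFlip, Bool.not_true, Bool.not_false]
    rw [add_comm (Measure.dirac (ErasureOutput.sign false))]
  · change ENNReal.ofReal (1 - (1 - u)) • Measure.dirac (ErasureOutput.sign x) +
      ENNReal.ofReal (1 - u) • Measure.dirac ErasureOutput.erased = _
    ext s hs
    rw [withDensity_apply _ hs, ← lintegral_indicator hs, erasureLaw]
    simp only [lintegral_add_measure, lintegral_smul_measure, lintegral_dirac, Measure.add_apply,
      Measure.smul_apply, Measure.dirac_apply, smul_eq_mul]
    have key : ENNReal.ofReal (u / 2) * 2 = ENNReal.ofReal u := by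
      rw [← ENNReal.ofReal_ofNat 2, ← ENNReal.ofReal_mul (by linarith)]
      congr 1
      ring
    have two : (1 : ℝ) + 1 = 2 := by norm_num
    cases x <;> by_cases ht : ErasureOutput.sign true ∈ s <;>
      by_cases hf : ErasureOutput.sign false ∈ s <;>
      by_cases hn : ErasureOutput.erased ∈ s <;>
      simp [Set.indicator, ht, hf, hn, erasureVal, sgn, key, two]

theorem erasureVal_eq (y : ErasureOutput) : erasureVal y = 0 ∨ |erasureVal y| = 1 := by
  rcases y with x | _
  · cases x <;> simp [erasureVal, sgn]
  · simp [erasureVal]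

theorem integral_erasureVal_sq {u : ℝ} (h0 : 0 ≤ u) :
    ∫ y, erasureVal y ^ 2 ∂(erasureLaw u) = u := by
  have hi : ∀ (y : ErasureOutput), Integrable (fun y => erasureVal y ^ 2) (Measure.dirac y) :=
    fun y => integrable_dirac (by simp)
  have hi2 := (hi (.sign true)).add_measure (hi (.sign false))
  rw [erasureLaw, integral_add_measure (hi2.smul_measure ENNReal.ofReal_ne_top)
    ((hi _).smul_measure ENNReal.ofReal_ne_top), integral_smul_measure, integral_smul_measure,
    integral_add_measure (hi _) (hi _), integral_dirac, integral_dirac, integral_dirac,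
    ENNReal.toReal_ofReal (by linarith)]
  simp [erasureVal, sgn]
  ring

/-! ### Polynomial form of the erased mean -/

/-- The number of signs that are not erased. -/
def numSome {n : ℕ} (w : Fin n → Option Bool) : ℕ := (Finset.univ.filter fun i => (w i).isSome).card

theorem numSome_le {n : ℕ} (w : Fin n → Option Bool) : numSome w ≤ n := by
  simpa [numSome] using Finset.card_filter_le (Finset.univ : Finset (Fin n)) fun i => (w i).isSome

theorem prod_erasedWeight {n : ℕ} (u : ℝ) (w : Fin n → Option Bool) :
    ∏ i, erasedWeight u (w i) = (u / 2) ^ numSome w * (1 - u) ^ (n - numSome w) := by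
  have h : ∀ i, erasedWeight u (w i) = if (w i).isSome then u / 2 else 1 - u := by
    intro i
    cases w i <;> simp [erasedWeight]
  simp_rw [h]
  rw [Finset.prod_ite, Finset.prod_const, Finset.prod_const, numSome]
  congr 2
  rw [Finset.filter_not, Finset.card_sdiff_of_subset (Finset.filter_subset _ _)]
  simp

/-- Without observed signs each likelihood is the total mass of its prior, so the numerator
vanishes. This is what makes `erasedMean` divisible by `u`. -/
theorem chiSqIntegrand_of_numSome_eq_zero {n : ℕ} {b : Bool → (Fin n → Bool) → ℝ}
    (hb : ∑ x, b true x = ∑ x, b false x) {w : Fin n → Option Bool} (hw : numSome w = 0) :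
    chiSqIntegrand b (fun i => erasedVal (w i)) = 0 := by
  have h : ∀ i, w i = none := by
    simpa [numSome, Finset.filter_eq_empty_iff] using hw
  simp [chiSqIntegrand, likelihood, h, erasedVal, hb]

/-- The polynomial `erasedMean b u / u`. -/
noncomputable def erasedPoly {n : ℕ} (b : Bool → (Fin n → Bool) → ℝ) : Polynomial ℝ :=
  ∑ w : Fin n → Option Bool, Polynomial.C
      (chiSqIntegrand b (fun i => erasedVal (w i)) / 2 ^ numSome w) *
    (Polynomial.X ^ (numSome w - 1) * (1 - Polynomial.X) ^ (n - numSome w)) *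
      -- Discards the fully erased pattern, for which the exponent `numSome w - 1` truncates to `0`.
      (if numSome w = 0 then 0 else 1)

theorem natDegree_erasedPoly_le {n : ℕ} (b : Bool → (Fin n → Bool) → ℝ) :
    (erasedPoly b).natDegree ≤ n - 1 := by
  refine Polynomial.natDegree_sum_le_of_forall_le _ _ fun w _ => ?_
  split_ifs with h
  · simp
  · rw [mul_one]
    refine (Polynomial.natDegree_C_mul_le _ _).trans (Polynomial.natDegree_mul_le.trans ?_)
    have h1 : (Polynomial.X ^ (numSome w - 1) : Polynomial ℝ).natDegree ≤ numSome w - 1 :=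
      Polynomial.natDegree_X_pow_le _
    have h2 : ((1 - Polynomial.X) ^ (n - numSome w) : Polynomial ℝ).natDegree ≤
        (n - numSome w) * 1 := by
      refine Polynomial.natDegree_pow_le_of_le _ ((Polynomial.natDegree_sub_le _ _).trans ?_)
      simp
    have := numSome_le w
    omega

theorem erasedPoly_eval_mul {n : ℕ} {b : Bool → (Fin n → Bool) → ℝ}
    (hb : ∑ x, b true x = ∑ x, b false x) (u : ℝ) :
    (erasedPoly b).eval u * u = erasedMean b u := by
  rw [erasedPoly, Polynomial.eval_finsetSum, Finset.sum_mul, erasedMean]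
  refine Finset.sum_congr rfl fun w _ => ?_
  rw [prod_erasedWeight]
  by_cases h : numSome w = 0
  · simp [h, chiSqIntegrand_of_numSome_eq_zero hb h]
  · obtain ⟨k, hk⟩ := Nat.exists_eq_succ_of_ne_zero h
    simp [hk, div_pow, pow_succ]
    ring

theorem erasedMean_nonneg {n : ℕ} {b : Bool → (Fin n → Bool) → ℝ} (hb : ∀ y x, 0 ≤ b y x)
    {u : ℝ} (h0 : 0 ≤ u) (h1 : u ≤ 1) : 0 ≤ erasedMean b u :=
  Finset.sum_nonneg fun _ _ => mul_nonneg
    (Finset.prod_nonneg fun _ _ => erasedWeight_nonneg h0 h1 _)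
    (chiSqIntegrand_nonneg hb fun _ => abs_erasedVal_le _)

theorem sum_transition {n : ℕ} (B : Kernel Bool (Fin n → Bool)) [IsMarkovKernel B] (y : Bool) :
    ∑ x, transition B y x = 1 := by
  simp only [transition]
  rw [sum_measureReal_singleton]
  simp

/-! ### The contraction coefficient as a supremum over erasure channels -/

theorem chiSqCapacity_erasedBroadcast (r : ℕ) (B : Kernel Bool (Fin (r - 1) → Bool))
    [IsMarkovKernel B] {u : ℝ} (h0 : 0 ≤ u) (h1 : u ≤ 1) :
    chiSqCapacity (erasedBroadcast r B u) = ENNReal.ofReal (erasedMean (transition B) u) := by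
  have := isMarkovKernel_bec h0 h1
  rw [erasedBroadcast, (hasCorrelation_bec h0 h1).chiSqCapacity_comp_eq erasureVal_eq,
    integral_erasureVal_sq h0]

theorem fBroadcast_eq (r : ℕ) (B : Kernel Bool (Fin (r - 1) → Bool))
    [IsMarkovKernel B] {u : ℝ} (h0 : 0 ≤ u) (h1 : u ≤ 1) :
    fBroadcast r B u = erasedMean (transition B) u / (((r : ℝ) - 1) * u) := by
  rw [fBroadcast, chiSqCapacity_erasedBroadcast r B h0 h1,
    ENNReal.toReal_ofReal (erasedMean_nonneg (transition_nonneg B) h0 h1)]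

theorem natCast_pred_real {r : ℕ} (hr : 2 ≤ r) : ((r - 1 : ℕ) : ℝ) = (r : ℝ) - 1 := by
  push_cast [Nat.cast_sub (by omega : 1 ≤ r)]
  ring

theorem ofReal_div_natCast_mul {r : ℕ} (hr : 2 ≤ r) {a u : ℝ} (hu : 0 < u) :
    ENNReal.ofReal a / (((r - 1 : ℕ) : ℝ≥0∞) * ENNReal.ofReal u) =
      ENNReal.ofReal (a / (((r : ℝ) - 1) * u)) := by
  have hpos : (0 : ℝ) < ((r - 1 : ℕ) : ℝ) := by
    have : 0 < r - 1 := by omega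
    exact_mod_cast this
  rw [← natCast_pred_real hr, ENNReal.ofReal_div_of_pos (by positivity),
    ENNReal.ofReal_mul hpos.le, ENNReal.ofReal_natCast]

/-- The ratio of each admissible `P` is bounded by `fBroadcast` at `C(P)`, that is, by the ratio of
the erasure channel of the same capacity. -/
theorem multiCoeff_le {r : ℕ} (hr : 2 ≤ r) (B : Kernel Bool (Fin (r - 1) → Bool))
    [IsMarkovKernel B] {M : ℝ} (hM : ∀ u ∈ Set.Ioc (0 : ℝ) 1, fBroadcast r B u ≤ M) :
    multiCoeff.{u} r B ≤ ENNReal.ofReal M := by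
  simp only [multiCoeff, iSup_le_iff]
  rintro Y _ P ⟨σ, hσ⟩ hpos _
  have := hσ.markov
  obtain ⟨Q, h, hc⟩ := hσ.exists_hasCorrelation
  rw [hc.chiSqCapacity_eq] at hpos ⊢
  have hu := ENNReal.ofReal_pos.1 hpos
  calc _ ≤ ENNReal.ofReal (erasedMean (transition B) (∫ y, h y ^ 2 ∂Q)) /
        (((r - 1 : ℕ) : ℝ≥0∞) * ENNReal.ofReal (∫ y, h y ^ 2 ∂Q)) :=
        ENNReal.div_le_div_right (hc.chiSqCapacity_comp_le B) _
    _ = ENNReal.ofReal (fBroadcast r B (∫ y, h y ^ 2 ∂Q)) := by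
        rw [ofReal_div_natCast_mul hr hu, fBroadcast_eq r B hu.le hc.integral_sq_le_one]
    _ ≤ _ := ENNReal.ofReal_le_ofReal (hM _ ⟨hu, hc.integral_sq_le_one⟩)

theorem le_multiCoeff {r : ℕ} (hr : 2 ≤ r) (B : Kernel Bool (Fin (r - 1) → Bool))
    [IsMarkovKernel B] {u : ℝ} (hu : u ∈ Set.Ioc (0 : ℝ) 1) :
    ENNReal.ofReal (fBroadcast r B u) ≤ multiCoeff.{u} r B := by
  have := isMarkovKernel_bec hu.1.le hu.2
  set e : ErasureOutput ≃ᵐ ULift.{u} ErasureOutput := MeasurableEquiv.ulift.symm with he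
  have hc := (hasCorrelation_bec hu.1.le hu.2).map e
  have hmk : IsMarkovKernel ((bec (1 - u)).map e) := Kernel.IsMarkovKernel.map _ e.measurable
  have hint : ∫ y, (erasureVal ∘ e.symm) y ^ 2 ∂((erasureLaw u).map e) = u := by
    rw [e.measurableEmbedding.integral_map]
    simpa using integral_erasureVal_sq hu.1.le
  have hcap := hc.chiSqCapacity_eq
  have hcomp := hc.chiSqCapacity_comp_eq (fun y => erasureVal_eq _) B
  rw [hint] at hcap hcomp
  have hterm : ENNReal.ofReal (fBroadcast r B u) =
      chiSqCapacity (tensorPow ((bec (1 - u)).map e) (r - 1) ∘ₖ B) /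
        (((r - 1 : ℕ) : ℝ≥0∞) * chiSqCapacity ((bec (1 - u)).map e)) := by
    rw [hcap, hcomp, ofReal_div_natCast_mul hr hu.1, fBroadcast_eq r B hu.1.le hu.2]
  rw [hterm]
  simp only [multiCoeff]
  refine le_iSup_of_le (ULift.{u} ErasureOutput) <| le_iSup_of_le inferInstance <|
    le_iSup_of_le ((bec (1 - u)).map e) <| le_iSup_of_le hc.isBMS <|
    le_iSup_of_le (by rw [hcap]; exact ENNReal.ofReal_pos.2 hu.1) <|
    le_iSup_of_le (by rw [hcap]; exact ENNReal.ofReal_lt_top) le_rfl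

theorem exists_polynomial_fBroadcast {r : ℕ} (B : Kernel Bool (Fin (r - 1) → Bool))
    [IsMarkovKernel B] :
    ∃ p : Polynomial ℝ, p.natDegree ≤ r - 2 ∧
      ∀ u ∈ Set.Ioc (0 : ℝ) 1, fBroadcast r B u = p.eval u := by
  refine ⟨Polynomial.C ((r : ℝ) - 1)⁻¹ * erasedPoly (transition B),
    (Polynomial.natDegree_C_mul_le _ _).trans (natDegree_erasedPoly_le _), fun u hu => ?_⟩
  rw [fBroadcast_eq r B hu.1.le hu.2, ← erasedPoly_eval_mul (by simp only [sum_transition]),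
    mul_div_mul_right _ _ hu.1.ne', div_eq_inv_mul]
  simp

/-- The polynomial extends `fBroadcast` to the compact interval `[0, 1]`, which gives the finiteness
of `multiCoeff`. -/
theorem exists_fBroadcast_le {r : ℕ} (B : Kernel Bool (Fin (r - 1) → Bool))
    [IsMarkovKernel B] : ∃ M : ℝ, ∀ u ∈ Set.Ioc (0 : ℝ) 1, fBroadcast r B u ≤ M := by
  obtain ⟨p, _, hp⟩ := exists_polynomial_fBroadcast B
  obtain ⟨M, hM⟩ := (isCompact_Icc (a := (0 : ℝ)) (b := 1)).bddAbove_image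
    p.continuous.continuousOn
  exact ⟨M, fun u hu => hp u hu ▸ hM ⟨u, Set.Ioc_subset_Icc_self hu, rfl⟩⟩

theorem multiCoeff_ne_top {r : ℕ} (hr : 2 ≤ r) (B : Kernel Bool (Fin (r - 1) → Bool))
    [IsMarkovKernel B] : multiCoeff.{u} r B ≠ ⊤ := by
  obtain ⟨M, hM⟩ := exists_fBroadcast_le B
  exact ne_top_of_le_ne_top ENNReal.ofReal_ne_top (multiCoeff_le hr B hM)

theorem fBroadcast_nonneg {r : ℕ} (hr : 2 ≤ r) (B : Kernel Bool (Fin (r - 1) → Bool)) {u : ℝ}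
    (hu : 0 ≤ u) : 0 ≤ fBroadcast r B u := by
  refine div_nonneg ENNReal.toReal_nonneg (mul_nonneg ?_ hu)
  rw [← natCast_pred_real hr]
  positivity

theorem isLUB_fBroadcast {r : ℕ} (hr : 2 ≤ r) (B : Kernel Bool (Fin (r - 1) → Bool))
    [IsMarkovKernel B] :
    IsLUB (fBroadcast r B '' Set.Ioc 0 1) (multiCoeff.{u} r B).toReal := by
  refine ⟨?_, fun M hM => ?_⟩
  · rintro _ ⟨u, hu, rfl⟩
    exact (ENNReal.ofReal_le_iff_le_toReal (multiCoeff_ne_top hr B)).1 (le_multiCoeff hr B hu)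
  · have hM' : ∀ u ∈ Set.Ioc (0 : ℝ) 1, fBroadcast r B u ≤ M := fun u hu => hM ⟨u, hu, rfl⟩
    -- Passing to real numbers needs `0 ≤ M`, which follows from the value at `1`.
    exact ENNReal.toReal_le_of_le_ofReal
      ((fBroadcast_nonneg hr B zero_le_one).trans (hM' 1 ⟨one_pos, le_rfl⟩))
      (multiCoeff_le hr B hM')

/-! ### The channels `B_{r,λ}` -/

/-- The transition probabilities of `specialBroadcast`. -/
noncomputable def specialProb (n : ℕ) (lam : ℝ) (y : Bool) (x : Fin n → Bool) : ℝ :=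
  if ∀ i, x i = y then lam + 1 / 2 ^ n * (1 - lam) else 1 / 2 ^ n * (1 - lam)

theorem specialProb_eq (n : ℕ) (lam : ℝ) (y : Bool) (x : Fin n → Bool) :
    specialProb n lam y x = (if x = fun _ => y then lam else 0) + 1 / 2 ^ n * (1 - lam) := by
  simp only [specialProb, funext_iff]
  split_ifs <;> ring

theorem specialProb_nonneg (n : ℕ) {lam : ℝ} (h : lam ∈ Set.Icc (0 : ℝ) 1) (y : Bool)
    (x : Fin n → Bool) : 0 ≤ specialProb n lam y x := by
  have h0 := h.1
  have h1 : 0 ≤ 1 / 2 ^ n * (1 - lam) := mul_nonneg (by positivity) (by linarith [h.2])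
  rw [specialProb_eq]
  split_ifs <;> linarith

theorem sum_specialProb_mul (n : ℕ) (lam : ℝ) (y : Bool) (F : (Fin n → Bool) → ℝ) :
    ∑ x, specialProb n lam y x * F x =
      lam * F (fun _ => y) + 1 / 2 ^ n * (1 - lam) * ∑ x, F x := by
  simp [specialProb_eq, add_mul, Finset.sum_add_distrib, Finset.mul_sum, ite_mul]

theorem specialBroadcast_apply (r : ℕ) (lam : ℝ) (y : Bool) {s : Set (Fin (r - 1) → Bool)} :
    specialBroadcast r lam y s =
      ∑ x, ENNReal.ofReal (specialProb (r - 1) lam y x) * s.indicator 1 x := by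
  change (∑ x, ENNReal.ofReal (specialProb (r - 1) lam y x) • Measure.dirac x) s = _
  simp [Measure.finsetSum_apply]

theorem isMarkovKernel_specialBroadcast (r : ℕ) {lam : ℝ} (h : lam ∈ Set.Icc (0 : ℝ) 1) :
    IsMarkovKernel (specialBroadcast r lam) := by
  refine ⟨fun y => ⟨?_⟩⟩
  rw [specialBroadcast_apply]
  simp only [Set.indicator_univ, Pi.one_apply, mul_one]
  rw [← ENNReal.ofReal_sum_of_nonneg fun x _ => specialProb_nonneg _ h y x]
  have := sum_specialProb_mul (r - 1) lam y 1
  simp only [Pi.one_apply, mul_one, Finset.sum_const, Finset.card_univ, Fintype.card_pi,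
    Fintype.card_bool, Finset.prod_const, Fintype.card_fin, nsmul_eq_mul, Nat.cast_pow,
    Nat.cast_ofNat] at this
  rw [this]
  field_simp
  simp

theorem signFlip_involutive (n : ℕ) : Function.Involutive (signFlip n) := fun x => by
  ext i
  simp [signFlip]

theorem isBMSWith_specialBroadcast (r : ℕ) {lam : ℝ} (h : lam ∈ Set.Icc (0 : ℝ) 1) :
    IsBMSWith (specialBroadcast r lam) (signFlip (r - 1)) := by
  refine ⟨isMarkovKernel_specialBroadcast r h, .of_discrete, signFlip_involutive _, fun E _ => ?_⟩
  rw [specialBroadcast_apply, specialBroadcast_apply,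
    (signFlip_involutive (r - 1)).image_eq_preimage_symm]
  refine Fintype.sum_equiv (signFlip_involutive (r - 1)).toPerm _ _ fun x => ?_
  rw [Function.Involutive.coe_toPerm]
  have h1 : specialProb (r - 1) lam false (signFlip (r - 1) x) = specialProb (r - 1) lam true x := by
    simp [specialProb, signFlip]
  have h2 : (signFlip (r - 1) x ∈ ((signFlip_involutive (r - 1)).toPerm.symm ⁻¹' E)) ↔ x ∈ E := by
    change signFlip (r - 1) (signFlip (r - 1) x) ∈ E ↔ _
    rw [signFlip_involutive (r - 1) x]
  rw [h1]
  congr 1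
  by_cases hx : x ∈ E
  · rw [Set.indicator_of_mem hx]
    exact (Set.indicator_of_mem (h2.2 hx) (1 : (Fin (r - 1) → Bool) → ℝ≥0∞)).symm
  · rw [Set.indicator_of_notMem hx]
    exact (Set.indicator_of_notMem (fun hx' => hx (h2.1 hx')) (1 : (Fin (r - 1) → Bool) → ℝ≥0∞)).symm

theorem transition_specialBroadcast (r : ℕ) {lam : ℝ} (h : lam ∈ Set.Icc (0 : ℝ) 1) :
    transition (specialBroadcast r lam) = specialProb (r - 1) lam := by
  ext y x
  rw [transition, measureReal_def, specialBroadcast_apply]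
  simp only [Set.indicator_apply, Set.mem_singleton_iff, Pi.one_apply, mul_ite, mul_one, mul_zero,
    Finset.sum_ite_eq', Finset.mem_univ, if_true]
  exact ENNReal.toReal_ofReal (specialProb_nonneg _ h y x)

/-- The prior mixes a point mass at the constant vector `y` with the uniform law, and the uniform
law has likelihood `1` because `(1 + t i) + (1 - t i) = 2` in each coordinate. -/
theorem likelihood_specialProb {n : ℕ} (lam : ℝ) (y : Bool) (t : Fin n → ℝ) :
    likelihood (specialProb n lam y) t = lam * ∏ i, (1 + sgn y * t i) + (1 - lam) := by
  rw [likelihood, sum_specialProb_mul]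
  have h : ∑ x : Fin n → Bool, ∏ i, (1 + sgn (x i) * t i) = 2 ^ n := by
    rw [← Fintype.prod_sum (fun i (a : Bool) => 1 + sgn a * t i)]
    simp only [Fintype.sum_bool, sgn]
    simp only [if_true, Bool.false_eq_true, if_false]
    ring_nf
    simp
  rw [h]
  field_simp

/-- All signs that are not erased equal `y`. -/
def AgreesWith {n : ℕ} (y : Bool) (w : Fin n → Option Bool) : Prop :=
  ∀ i, w i ≠ some (!y)

instance {n : ℕ} (y : Bool) (w : Fin n → Option Bool) : Decidable (AgreesWith y w) :=
  inferInstanceAs (Decidable (∀ i, w i ≠ some (!y)))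

theorem prod_one_add_sgn_mul_erasedVal {n : ℕ} (y : Bool) (w : Fin n → Option Bool) :
    ∏ i, (1 + sgn y * erasedVal (w i)) = if AgreesWith y w then 2 ^ numSome w else 0 := by
  split_ifs with h
  · have hi : ∀ i, 1 + sgn y * erasedVal (w i) = if (w i).isSome then 2 else 1 := by
      intro i
      have := h i
      rcases hw : w i with _ | z
      · simp [erasedVal]
      · cases y <;> cases z <;> simp_all [erasedVal, sgn] <;> norm_num
    simp_rw [hi]
    rw [Finset.prod_ite, Finset.prod_const, Finset.prod_const_one, mul_one, numSome]
  · simp only [AgreesWith, not_forall, not_not] at h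
    obtain ⟨i, hi⟩ := h
    refine Finset.prod_eq_zero (Finset.mem_univ i) ?_
    rw [hi]
    cases y <;> simp [erasedVal, sgn]

theorem not_agreesWith_true_and_false {n : ℕ} {w : Fin n → Option Bool} (hw : numSome w ≠ 0) :
    ¬(AgreesWith true w ∧ AgreesWith false w) := by
  rintro ⟨h1, h2⟩
  refine hw ?_
  rw [numSome, Finset.card_eq_zero, Finset.filter_eq_empty_iff]
  intro i _
  have := h1 i
  have := h2 i
  rcases hi : w i with _ | _ | _ <;> simp_all

/-- The contribution to `fSpecial` of an observation of `k` signs. -/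
noncomputable def specialTerm (lam : ℝ) (k : ℕ) : ℝ :=
  lam ^ 2 / (lam + (1 - lam) * (2 : ℝ) ^ (1 - (k : ℤ)))

/-- When `k + 1` signs are seen and all agree, the likelihoods are `lam * 2 ^ (k + 1) + (1 - lam)`
and `1 - lam`; the left side is their squared half-difference over their half-sum. -/
theorem specialTerm_succ {lam : ℝ} (h : lam ∈ Set.Icc (0 : ℝ) 1) (k : ℕ) :
    (lam * 2 ^ k) ^ 2 / (lam * 2 ^ k + (1 - lam)) = 2 ^ k * specialTerm lam (k + 1) := by
  have h1 : (2 : ℝ) ^ (1 - ((k + 1 : ℕ) : ℤ)) = (2 ^ k)⁻¹ := by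
    rw [← zpow_natCast, ← zpow_neg]
    congr 1
    push_cast
    ring
  have hk : (1 : ℝ) ≤ 2 ^ k := one_le_pow₀ (by norm_num)
  have hpos : 0 < lam * 2 ^ k + (1 - lam) := by nlinarith [h.1, h.2]
  have hpos' : lam + (1 - lam) * (2 ^ k)⁻¹ ≠ 0 := by
    have : lam + (1 - lam) * (2 ^ k)⁻¹ = (lam * 2 ^ k + (1 - lam)) / 2 ^ k := by field_simp
    rw [this]
    positivity
  rw [specialTerm, h1, ← mul_div_assoc, div_eq_div_iff hpos.ne' hpos']
  field_simp

theorem chiSqIntegrand_specialProb {n : ℕ} {lam : ℝ} (h : lam ∈ Set.Icc (0 : ℝ) 1)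
    {w : Fin n → Option Bool} {k : ℕ} (hw : numSome w = k + 1) :
    chiSqIntegrand (specialProb n lam) (fun i => erasedVal (w i)) =
      2 ^ k * specialTerm lam (k + 1) *
        ((if AgreesWith true w then 1 else 0) + if AgreesWith false w then 1 else 0) := by
  have hne := not_agreesWith_true_and_false (w := w) (by omega)
  simp only [chiSqIntegrand, likelihood_specialProb, prod_one_add_sgn_mul_erasedVal, hw]
  rw [← specialTerm_succ h]
  by_cases h1 : AgreesWith true w <;> by_cases h2 : AgreesWith false w
  · exact absurd ⟨h1, h2⟩ hne
  · simp only [h1, h2, if_true, if_false]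
    rw [add_zero, mul_one, pow_succ]
    congr 1 <;> ring
  · simp only [h1, h2, if_true, if_false]
    rw [zero_add, mul_one, pow_succ]
    congr 1 <;> ring
  · simp [h1, h2]

/-- A pattern agreeing with `y` is determined by its set of unerased positions. -/
theorem sum_agreesWith {n : ℕ} (y : Bool) (g : ℕ → ℝ) :
    ∑ w : Fin n → Option Bool, g (numSome w) * (if AgreesWith y w then 1 else 0) =
      ∑ k ∈ Finset.range (n + 1), (n.choose k : ℝ) * g k := by
  have h1 : ∑ A ∈ (Finset.univ : Finset (Fin n)).powerset, g A.card =
      ∑ k ∈ Finset.range (n + 1), (n.choose k : ℝ) * g k := by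
    rw [Finset.sum_powerset_apply_card]
    simp
  rw [← h1, Finset.powerset_univ]
  simp only [mul_ite, mul_one, mul_zero]
  rw [← Finset.sum_filter]
  refine Finset.sum_nbij' (fun w => Finset.univ.filter fun i => (w i).isSome)
    (fun A i => if i ∈ A then some y else none) (by simp) ?_ ?_ ?_ ?_
  · intro A _
    refine Finset.mem_filter.2 ⟨Finset.mem_univ _, fun i => ?_⟩
    by_cases hi : i ∈ A <;> simp [hi]
  · intro w hw
    ext1 i
    have := (Finset.mem_filter.1 hw).2 i
    rcases hi : w i with _ | z
    · simp [hi]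
    · cases y <;> cases z <;> simp_all
  · intro A _
    ext i
    by_cases hi : i ∈ A <;> simp [hi]
  · intro w _
    rfl

theorem erasedMean_specialProb {n : ℕ} {lam : ℝ} (h : lam ∈ Set.Icc (0 : ℝ) 1) (u : ℝ) :
    erasedMean (specialProb n lam) u =
      u * ∑ i ∈ Finset.Icc 1 n,
        (n.choose i : ℝ) * (1 - u) ^ (n - i) * u ^ (i - 1) * specialTerm lam i := by
  -- The weights carry `2 ^ (-k)` and the integrand `2 ^ (k - 1)`, leaving the factor `1 / 2`; the
  -- two choices of the common sign cancel it.
  set g : ℕ → ℝ := fun k =>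
    if k = 0 then 0 else u ^ k * (1 - u) ^ (n - k) * specialTerm lam k / 2 with hg
  have h1 : erasedMean (specialProb n lam) u = ∑ w : Fin n → Option Bool,
      (g (numSome w) * (if AgreesWith true w then 1 else 0) +
        g (numSome w) * (if AgreesWith false w then 1 else 0)) := by
    refine Finset.sum_congr rfl fun w _ => ?_
    rcases hw : numSome w with _ | k
    · rw [chiSqIntegrand_of_numSome_eq_zero _ hw]
      · simp [hg]
      · have hs := fun y => sum_specialProb_mul n lam y 1
        simp only [Pi.one_apply, mul_one] at hs
        rw [hs, hs]
    · rw [prod_erasedWeight, chiSqIntegrand_specialProb h hw, hw, ← mul_add]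
      simp only [hg, Nat.add_eq_zero_iff, one_ne_zero, and_false, if_false]
      rw [div_pow, pow_succ (2 : ℝ)]
      field_simp
  rw [h1, Finset.sum_add_distrib, sum_agreesWith, sum_agreesWith, ← two_mul, Finset.mul_sum,
    Finset.mul_sum, Finset.sum_range_succ', ← Finset.sum_image (s := Finset.range n)
      (g := fun k => k + 1) (f := fun k => 2 * ((n.choose k : ℝ) * g k))
      (fun _ _ _ _ hab => Nat.succ_injective hab)]
  have himage : (Finset.range n).image (fun k => k + 1) = Finset.Icc 1 n := by
    ext k
    simp only [Finset.mem_image, Finset.mem_range, Finset.mem_Icc]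
    exact ⟨by rintro ⟨a, ha, rfl⟩; omega, fun hk => ⟨k - 1, by omega, by omega⟩⟩
  rw [himage]
  simp only [hg, if_true, mul_zero, add_zero]
  refine Finset.sum_congr rfl fun k hk => ?_
  obtain ⟨m, rfl⟩ := Nat.exists_eq_add_of_le' (Finset.mem_Icc.1 hk).1
  rw [if_neg (by omega), Nat.add_sub_cancel, pow_succ]
  ring

theorem fBroadcast_specialBroadcast {r : ℕ} {lam : ℝ}
    (h : lam ∈ Set.Icc (0 : ℝ) 1) {u : ℝ} (hu : u ∈ Set.Ioc (0 : ℝ) 1) :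
    fBroadcast r (specialBroadcast r lam) u = fSpecial r lam u := by
  have := isMarkovKernel_specialBroadcast r h
  rw [fBroadcast_eq r _ hu.1.le hu.2, transition_specialBroadcast r h, erasedMean_specialProb h,
    mul_comm u, mul_div_mul_right _ _ hu.1.ne', fSpecial, div_eq_inv_mul, one_div]
  rfl

end MultiSDPI

theorem mainTheorem6 (r : ℕ) (hr : 2 ≤ r) :
    (∀ B : Kernel Bool (Fin (r - 1) → Bool),
      MultiSDPI.IsBMSWith B (MultiSDPI.signFlip (r - 1)) →
        (∀ ε ∈ Set.Ioc (0 : ℝ) 1,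
          MultiSDPI.chiSqCapacity (MultiSDPI.erasedBroadcast r B ε) ≠ ⊤) ∧
        MultiSDPI.multiCoeff.{u} r B ≠ ⊤ ∧
        IsLUB (MultiSDPI.fBroadcast r B '' Set.Ioc 0 1) (MultiSDPI.multiCoeff.{u} r B).toReal ∧
        ∃ p : Polynomial ℝ, p.natDegree ≤ r - 2 ∧
          ∀ ε ∈ Set.Ioc (0 : ℝ) 1, MultiSDPI.fBroadcast r B ε = p.eval ε) ∧
    (∀ lam ∈ Set.Icc (0 : ℝ) 1,
      MultiSDPI.IsBMSWith (MultiSDPI.specialBroadcast r lam) (MultiSDPI.signFlip (r - 1)) ∧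
      (∀ ε ∈ Set.Ioc (0 : ℝ) 1,
        MultiSDPI.fBroadcast r (MultiSDPI.specialBroadcast r lam) ε = MultiSDPI.fSpecial r lam ε) ∧
      IsLUB (MultiSDPI.fSpecial r lam '' Set.Ioc 0 1)
        (MultiSDPI.multiCoeff.{u} r (MultiSDPI.specialBroadcast r lam)).toReal) := by
  refine ⟨fun B hB => ?_, fun lam hlam => ?_⟩
  · have := hB.markov
    refine ⟨fun ε hε => ?_, MultiSDPI.multiCoeff_ne_top hr B, MultiSDPI.isLUB_fBroadcast hr B,
      MultiSDPI.exists_polynomial_fBroadcast B⟩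
    rw [MultiSDPI.chiSqCapacity_erasedBroadcast r B hε.1.le hε.2]
    exact ENNReal.ofReal_ne_top
  · have hB := MultiSDPI.isBMSWith_specialBroadcast r hlam
    have := hB.markov
    have heq := fun ε (hε : ε ∈ Set.Ioc (0 : ℝ) 1) =>
      MultiSDPI.fBroadcast_specialBroadcast (r := r) hlam hε
    refine ⟨hB, heq, ?_⟩
    rw [← Set.image_congr heq]
    exact MultiSDPI.isLUB_fBroadcast hr _
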